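/- **Setting.** Let $d,T,m,n$ be positive integers with $m$ even. Let $\mathcal X$ be the set of $X=(X_1,\dots,X_T)\in\mathbb R^{d\times T}$ with $\|X_t\|_2\le 1$ for all $t$, let $X\mapsto q_X\in\mathbb R^d$ be a fixed map with $\|q_X\|_2\le 1$ for all $X\in\mathcal X$, and let $X^{(1)},\dots,X^{(n)}\in\mathcal X$ be fixed. Let $\sigma:\mathbb R\to\mathbb R$ be twice differentiable with $|\sigma|\le\sigma_0$, $|\sigma'|\le\sigma_1$, $|\sigma''|\le\sigma_2$. Write $\sigma_s$ for the softmax on $\mathbb R^T$, $J_s(z)=\operatorname{diag}(\sigma_s(z))-\sigma_s(z)\sigma_s(z)^\top$ for its Jacobian matrix, $\langle A,B\rangle_F=\operatorname{tr}(A^\top B)$, and $$a(X;W)=X\sigma_s(X^\top Wq_X),\qquad M(X;W)=X\,J_s(X^\top Wq_X)\,X^\top .$$ For $\varphi=(\varphi_i)_{i=1}^m$ with $\varphi_i=(c_i,U_i,\operatorname{vec}(W_i))\in\mathbb R^{1+d+d^2}$, the model is $$f(X;\varphi)=\frac1{\sqrt m}\sum_{i=1}^m c_i\,\sigma\big(U_i^\top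 a(X;W_i)\big).$$ **Initialization.** The random parameters $\varphi^{(0)}$ are drawn as follows: for $i\le m/2$, $c^{(0)}_i$ is uniform on $\{-1,1\}$, $U^{(0)}_i\sim\mathcal N(0,I_d)$, $W^{(0)}_i$ has i.i.d. $\mathcal N(0,1)$ entries, and all these draws are mutually independent; moreover $(c^{(0)}_{i+m/2},U^{(0)}_{i+m/2},W^{(0)}_{i+m/2})=(-c^{(0)}_i,U^{(0)}_i,W^{(0)}_i)$. The linearized model is $$f_{\mathrm{lin}}(X;\varphi)=f(X;\varphi^{(0)})+\big\langle\nabla_\varphi f(X;\varphi^{(0)}),\varphi-\varphi^{(0)}\big\rangle .$$ **Target class.** Let $v=(v_c,v_u,v_w):\mathbb R^{1+d+d^2}\to\mathbb R\times\mathbb R^d\times\mathbb R^{d\times d}$ be measurable (and deterministic) with $\sup|v_c|\le\bar\nu_c$, $\sup\|v_u\|_2\le\bar\nu_u$, $\sup\|v_w\|_F\le\bar\nu_w$. With $\varphi_0=(c,U,\operatorname{vec}(W))$ distributed as $\varphi^{(0)}_1$, $a=a(X;W)$ and $M=M(X;W)$, put $$\tilde f(X;v)=\mathbb E\big[\sigma(U^\top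 a)\,v_c(\varphi_0)\big]+\mathbb E\big[\sigma'(U^\top a)\langle a,v_u(\varphi_0)\rangle\big]+\mathbb E\big[\sigma'(U^\top a)\langle (MU)q_X^\top,v_w(\varphi_0)\rangle_F\big],$$ and let $\tilde\varphi=(\tilde c_i,\tilde U_i,\operatorname{vec}(\tilde W_i))_{i=1}^m$ with $$\tilde c_i=c^{(0)}_i+\tfrac{1}{\sqrt m}v_c(\varphi^{(0)}_i),\quad \tilde U_i=U^{(0)}_i+\tfrac{c^{(0)}_i}{\sqrt m}v_u(\varphi^{(0)}_i),\quad \tilde W_i=W^{(0)}_i+\tfrac{c^{(0)}_i}{\sqrt m}v_w(\varphi^{(0)}_i).$$ **Lemma (approximation error).** For every $\delta\in(0,1)$, with probability at least $1-\delta$ over the initialization $\varphi^{(0)}$, $$\sup_{1\le j\le n}\big|f_{\mathrm{lin}}(X^{(j)};\tilde\varphi)-\tilde f(X^{(j)};v)\big|\;\le\;2\,(\sigma_0\bar\nu_c+\sigma_1\bar\nu_u+\sigma_1\bar\nu_w)\sqrt{\frac{2\log(2n/\delta)}{m}} .$$ In particular the bound is logarithmic in $n$ and does not depend on $T$ or $d$.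 -/

import Mathlib

open MeasureTheory ProbabilityTheory
open scoped Matrix ENNReal

noncomputable section

namespace ShallowTransformer

/-! ### Parameters -/

/-- Coordinates of the parameters `(c, U, vec W)` of one head:
one output weight, `d` hidden weights, `d * d` attention weights. -/
abbrev NeuronIdx (d : ℕ) : Type := Unit ⊕ Fin d ⊕ (Fin d × Fin d)

/-- Parameters `(c, U, vec W)` of one head, a vector of `ℝ^(1 + d + d²)` with its
Euclidean structure. -/
abbrev Neuron (d : ℕ) : Type := EuclideanSpace ℝ (NeuronIdx d)

namespace Neuron

variable {d : ℕ}

/-- Output weight `c`. -/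
def c (θ : Neuron d) : ℝ := θ (Sum.inl ())

/-- Hidden weights `U`. -/
def U (θ : Neuron d) : EuclideanSpace ℝ (Fin d) :=
  WithLp.toLp 2 fun k => θ (Sum.inr (Sum.inl k))

/-- Attention weights `W`. -/
def W (θ : Neuron d) : Matrix (Fin d) (Fin d) ℝ :=
  Matrix.of fun k l => θ (Sum.inr (Sum.inr (k, l)))

/-- The head with parameters `(c, U, vec W)`. -/
def mk (c : ℝ) (U : EuclideanSpace ℝ (Fin d)) (W : Matrix (Fin d) (Fin d) ℝ) : Neuron d :=
  WithLp.toLp 2 (Sum.elim (fun _ => c) (Sum.elim (fun k => U k) fun p => W p.1 p.2))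

@[simp] theorem c_mk (c : ℝ) (U : EuclideanSpace ℝ (Fin d)) (W : Matrix (Fin d) (Fin d) ℝ) :
    (mk c U W).c = c := rfl

@[simp] theorem U_mk (c : ℝ) (U : EuclideanSpace ℝ (Fin d)) (W : Matrix (Fin d) (Fin d) ℝ) :
    (mk c U W).U = U := rfl

@[simp] theorem W_mk (c : ℝ) (U : EuclideanSpace ℝ (Fin d)) (W : Matrix (Fin d) (Fin d) ℝ) :
    (mk c U W).W = W := rfl

end Neuron

/-- Parameters `φ = (φ₁, …, φₘ)` of the whole model, with the Euclidean structure. -/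
abbrev Params (d m : ℕ) : Type := PiLp 2 fun _ : Fin m => Neuron d

/-- Frobenius inner product `tr (Aᵀ B)`. -/
def frobInner {d : ℕ} (A B : Matrix (Fin d) (Fin d) ℝ) : ℝ := (Aᵀ * B).trace

/-- Frobenius norm. -/
def frobNorm {d : ℕ} (A : Matrix (Fin d) (Fin d) ℝ) : ℝ := √(frobInner A A)

/-! ### The model -/

/-- Inputs: sequences of `T` tokens (the columns of `X`), each of Euclidean norm at most `1`. -/
def inputSpace (d T : ℕ) : Set (Matrix (Fin d) (Fin T) ℝ) :=
  {X | ∀ t, ‖(WithLp.toLp 2 fun k => X k t : EuclideanSpace ℝ (Fin d))‖ ≤ 1}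

/-- Twice differentiable activations with uniform bounds on `σ`, `σ'`, `σ''`. -/
structure IsBoundedActivation (σ : ℝ → ℝ) (σ₀ σ₁ σ₂ : ℝ) : Prop where
  differentiable : Differentiable ℝ σ
  differentiable_deriv : Differentiable ℝ (deriv σ)
  abs_le : ∀ u, |σ u| ≤ σ₀
  abs_deriv_le : ∀ u, |deriv σ u| ≤ σ₁
  abs_deriv_deriv_le : ∀ u, |deriv (deriv σ) u| ≤ σ₂

/-- Softmax. -/
def softmax {T : ℕ} (z : Fin T → ℝ) : Fin T → ℝ :=
  fun t => Real.exp (z t) / ∑ s, Real.exp (z s)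

/-- Jacobian matrix of softmax, `diag (softmax z) - softmax z (softmax z)ᵀ`. -/
def softmaxJac {T : ℕ} (z : Fin T → ℝ) : Matrix (Fin T) (Fin T) ℝ :=
  Matrix.diagonal (softmax z) - Matrix.vecMulVec (softmax z) (softmax z)

variable {d T m : ℕ}

/-- Attention scores `Xᵀ W q`. -/
def scores (q : EuclideanSpace ℝ (Fin d)) (X : Matrix (Fin d) (Fin T) ℝ)
    (W : Matrix (Fin d) (Fin d) ℝ) : Fin T → ℝ :=
  Xᵀ *ᵥ (W *ᵥ q.ofLp)

/-- Attention layer `a(X; W) = X softmax(Xᵀ W q)`. -/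
def attn (q : EuclideanSpace ℝ (Fin d)) (X : Matrix (Fin d) (Fin T) ℝ)
    (W : Matrix (Fin d) (Fin d) ℝ) : EuclideanSpace ℝ (Fin d) :=
  WithLp.toLp 2 (X *ᵥ softmax (scores q X W))

/-- `M(X; W) = X J(Xᵀ W q) Xᵀ`, with `J` the Jacobian of softmax. -/
def attnCov (q : EuclideanSpace ℝ (Fin d)) (X : Matrix (Fin d) (Fin T) ℝ)
    (W : Matrix (Fin d) (Fin d) ℝ) : Matrix (Fin d) (Fin d) ℝ :=
  X * softmaxJac (scores q X W) * Xᵀ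

/-- Feed-forward layer `h(X; (U, W)) = σ(Uᵀ a(X; W))`. -/
def feedForward (σ : ℝ → ℝ) (q : EuclideanSpace ℝ (Fin d)) (X : Matrix (Fin d) (Fin T) ℝ)
    (θ : Neuron d) : ℝ :=
  σ (inner ℝ θ.U (attn q X θ.W))

/-- The Transformer `f(X; φ) = m^(-1/2) ∑ᵢ cᵢ h(X; θᵢ)`.
The query map `q` assigns to each input its query vector. -/
def model (σ : ℝ → ℝ) (q : Matrix (Fin d) (Fin T) ℝ → EuclideanSpace ℝ (Fin d))
    (X : Matrix (Fin d) (Fin T) ℝ) (φ : Params d m) : ℝ :=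
  1 / √(m : ℝ) * ∑ i, (φ i).c * feedForward σ (q X) X (φ i)

/-- Linearization of the model in the parameters at `φ₀`:
`f(X; φ₀) + ⟨∇f(X; φ₀), φ - φ₀⟩`. -/
def linModel (σ : ℝ → ℝ) (q : Matrix (Fin d) (Fin T) ℝ → EuclideanSpace ℝ (Fin d))
    (φ₀ : Params d m) (X : Matrix (Fin d) (Fin T) ℝ) (φ : Params d m) : ℝ :=
  model σ q X φ₀ + inner ℝ (gradient (fun ψ : Params d m => model σ q X ψ) φ₀) (φ - φ₀)

/-! ### Symmetric random initialization -/

/-- Uniform distribution on `{-1, 1}`. -/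
def rademacher : Measure ℝ :=
  (2⁻¹ : ℝ≥0∞) • Measure.dirac (-1) + (2⁻¹ : ℝ≥0∞) • Measure.dirac 1

/-- Marginal laws of the coordinates of one head: `c` is Rademacher, and every entry of `U`
and of `W` is standard Gaussian. -/
def coordLaw (d : ℕ) : NeuronIdx d → Measure ℝ
  | Sum.inl _ => rademacher
  | Sum.inr _ => gaussianReal 0 1

/-- Law of one head at initialization: all coordinates independent. -/
def neuronLaw (d : ℕ) : Measure (Neuron d) :=
  (Measure.pi (coordLaw d)).map (WithLp.toLp 2)

/-- `(c, U, W) ↦ (-c, U, W)`. -/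
def Neuron.flip (θ : Neuron d) : Neuron d := Neuron.mk (-θ.c) θ.U θ.W

theorem mirror_idx (hm : Even m) (i : Fin m) : (i : ℕ) - m / 2 < m / 2 := by
  obtain ⟨k, rfl⟩ := hm
  omega

/-- Extend `m / 2` heads to `m` heads: head `i + m / 2` is head `i` with `c` negated. -/
def mirror (hm : Even m) (θ : Fin (m / 2) → Neuron d) : Params d m :=
  WithLp.toLp 2 fun i =>
    if h : (i : ℕ) < m / 2 then θ ⟨i, h⟩
    else (θ ⟨i - m / 2, mirror_idx hm i⟩).flip

/-- Law of the symmetric initialization: the first `m / 2` heads are independent with law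
`neuronLaw d`, the others are their mirror images. -/
def symmetricInitLaw (d : ℕ) (hm : Even m) : Measure (Params d m) :=
  (Measure.pi fun _ : Fin (m / 2) => neuronLaw d).map (mirror hm)

instance : IsProbabilityMeasure rademacher := by
  constructor
  simp [rademacher, ENNReal.inv_two_add_inv_two]

instance (k : NeuronIdx d) : IsProbabilityMeasure (coordLaw d k) := by
  rcases k with k | k <;> simp only [coordLaw] <;> infer_instance

instance : IsProbabilityMeasure (neuronLaw d) :=
  Measure.isProbabilityMeasure_map (by fun_prop)

theorem Neuron.measurable_flip : Measurable (Neuron.flip (d := d)) := by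
  unfold Neuron.flip Neuron.mk Neuron.c Neuron.U Neuron.W
  refine (WithLp.measurable_toLp 2 _).comp (measurable_pi_lambda _ ?_)
  rintro (k | k | k) <;> simp <;> fun_prop

theorem measurable_mirror (hm : Even m) : Measurable (mirror (d := d) hm) := by
  unfold mirror
  refine (WithLp.measurable_toLp 2 _).comp (measurable_pi_lambda _ fun i => ?_)
  split_ifs with h
  · exact measurable_pi_apply _
  · have hi : (i : ℕ) - m / 2 < m / 2 := mirror_idx hm i
    have h2 : Measurable fun θ : Fin (m / 2) → Neuron d => θ ⟨i - m / 2, hi⟩ :=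
      measurable_pi_apply _
    exact Neuron.measurable_flip.comp h2

instance (hm : Even m) : IsProbabilityMeasure (symmetricInitLaw d hm) :=
  Measure.isProbabilityMeasure_map (measurable_mirror hm).aemeasurable

/-! ### Transportation mappings -/

/-- Random feature `φ_c(X) = σ(Uᵀ a)`. -/
def featC (σ : ℝ → ℝ) (q : EuclideanSpace ℝ (Fin d)) (X : Matrix (Fin d) (Fin T) ℝ)
    (θ : Neuron d) : ℝ :=
  σ (inner ℝ θ.U (attn q X θ.W))

/-- Random feature `φ_u(X) = σ'(Uᵀ a) a`. -/
def featU (σ : ℝ → ℝ) (q : EuclideanSpace ℝ (Fin d)) (X : Matrix (Fin d) (Fin T) ℝ)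
    (θ : Neuron d) : EuclideanSpace ℝ (Fin d) :=
  deriv σ (inner ℝ θ.U (attn q X θ.W)) • attn q X θ.W

/-- Random feature `φ_w(X) = σ'(Uᵀ a) (M U) qᵀ`. -/
def featW (σ : ℝ → ℝ) (q : EuclideanSpace ℝ (Fin d)) (X : Matrix (Fin d) (Fin T) ℝ)
    (θ : Neuron d) : Matrix (Fin d) (Fin d) ℝ :=
  deriv σ (inner ℝ θ.U (attn q X θ.W)) •
    Matrix.vecMulVec (attnCov q X θ.W *ᵥ θ.U.ofLp) q.ofLp

/-- The function `f̃(·; v)`; the expectations are over one head drawn from its initial law.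
A transportation mapping `v = (v_c, v_u, v_w)` takes the parameters of a head to a triple in
`ℝ × ℝ^d × ℝ^(d × d)`, which is again written as an element of `Neuron d`. -/
def transportFun (σ : ℝ → ℝ) (q : Matrix (Fin d) (Fin T) ℝ → EuclideanSpace ℝ (Fin d))
    (v : Neuron d → Neuron d) (X : Matrix (Fin d) (Fin T) ℝ) : ℝ :=
  (∫ θ, featC σ (q X) X θ * (v θ).c ∂neuronLaw d)
    + (∫ θ, inner ℝ (featU σ (q X) X θ) (v θ).U ∂neuronLaw d)
    + ∫ θ, frobInner (featW σ (q X) X θ) (v θ).W ∂neuronLaw d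

/-- The measurable transportation mappings with
`sup |v_c| ≤ ν_c`, `sup ‖v_u‖₂ ≤ ν_u`, `sup ‖v_w‖_F ≤ ν_w`. -/
structure IsBoundedTransport (v : Neuron d → Neuron d) (νc νu νw : ℝ) : Prop where
  measurable : Measurable v
  c_le : ∀ θ, |(v θ).c| ≤ νc
  u_le : ∀ θ, ‖(v θ).U‖ ≤ νu
  w_le : ∀ θ, frobNorm (v θ).W ≤ νw

/-- The transported parameters: `cᵢ + m^(-1/2) v_c(φᵢ)`, `Uᵢ + cᵢ m^(-1/2) v_u(φᵢ)`,
`Wᵢ + cᵢ m^(-1/2) v_w(φᵢ)`. -/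
def transported (v : Neuron d → Neuron d) (φ : Params d m) : Params d m :=
  WithLp.toLp 2 fun i =>
    Neuron.mk
      ((φ i).c + 1 / √(m : ℝ) * (v (φ i)).c)
      ((φ i).U + ((φ i).c * (1 / √(m : ℝ))) • (v (φ i)).U)
      ((φ i).W + ((φ i).c * (1 / √(m : ℝ))) • (v (φ i)).W)

end ShallowTransformer

end

open ShallowTransformer

noncomputable section

namespace ShallowTransformer

/-! ### Linearization of the model -/

section Gradient

variable {d T m : ℕ}

/-! At a mirrored initialization the heads cancel in pairs, so the model vanishes there and the
linearized model is its gradient term alone. The hidden and attention displacements carry the sign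
`c`, which meets the factor `c` in the gradient and gives `c ^ 2 = 1`; the two factors `1 / √m`
combine to `1 / m`. What remains is the mean of `transportFeature` over the `m` heads
(`inner_gradient_transported`). Pairing each head with its mirror image turns it into an average of
`N = m / 2` independent copies of `mirroredFeature`. Since the law of a head is invariant under
flipping `c`, their common mean is `transportFun`. The rest is concentration and a union bound over
the inputs.

The feature is unbounded, because `M U` is linear in the Gaussian `U`: it is only dominated by `A +
B * ‖M U‖`, with `A = σ₀ νc + σ₁ νu` and `B = σ₁ νw`. A bound free of `d` and `T` comes from reading
`M` as the covariance of a token `x_t` drawn with the attention weights `p_t`, with mean `a`. Then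
`‖M U‖ ≤ ∑ p_t ‖x_t - a‖² |⟨u_t, U⟩|` with `‖u_t‖ ≤ 1`, and the total weight is a variance, at most
`1`. Convexity of `cosh` and the Gaussian moment generating function give `E cosh (l ‖M U‖) ≤ exp
(l² / 2)`, as for a single standard Gaussian.

A second use of convexity gives `E cosh (l Z) ≤ exp (l² S² / 2)` for the feature `Z`, with `S = A +
B`. Centring squares this bound and leaves variance proxy `2 S²` (`hasSubgaussianMGF_sub_integral`).
With `N = m / 2`, Hoeffding's inequality then yields exactly the constant `2 S √(2 L / m)`, where `L
= log (2 n / δ)`. -/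

theorem softmaxJac_mulVec (z y : Fin T → ℝ) (t : Fin T) :
    (softmaxJac z *ᵥ y) t = softmax z t * (y t - softmax z ⬝ᵥ y) := by
  rw [softmaxJac, Matrix.sub_mulVec, Pi.sub_apply, Matrix.mulVec_diagonal,
    Matrix.vecMulVec_mulVec]
  simp
  ring

theorem softmaxJac_transpose (z : Fin T → ℝ) : (softmaxJac z)ᵀ = softmaxJac z := by
  ext s t
  simp only [softmaxJac, Matrix.transpose_apply, Matrix.sub_apply, Matrix.vecMulVec_apply,
    Matrix.diagonal_apply, mul_comm (softmax z t)]
  by_cases h : s = t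
  · subst h; rfl
  · rw [if_neg h, if_neg (Ne.symm h)]

theorem attnCov_transpose (q : EuclideanSpace ℝ (Fin d)) (X : Matrix (Fin d) (Fin T) ℝ)
    (W : Matrix (Fin d) (Fin d) ℝ) : (attnCov q X W)ᵀ = attnCov q X W := by
  simp only [attnCov, Matrix.transpose_mul, softmaxJac_transpose, Matrix.transpose_transpose,
    Matrix.mul_assoc]

theorem sum_exp_pos (z : Fin T → ℝ) (t : Fin T) : 0 < ∑ s, Real.exp (z s) :=
  Finset.sum_pos (fun _ _ => Real.exp_pos _) ⟨t, Finset.mem_univ t⟩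

theorem hasDerivAt_softmax {z : ℝ → Fin T → ℝ} {z' : Fin T → ℝ} {s : ℝ}
    (hz : HasDerivAt z z' s) :
    HasDerivAt (fun r => softmax (z r)) (softmaxJac (z s) *ᵥ z') s := by
  rw [hasDerivAt_pi] at hz ⊢
  intro t
  have hS := (sum_exp_pos (z s) t).ne'
  have h := (hz t).exp.fun_div (HasDerivAt.fun_sum fun i (_ : i ∈ Finset.univ) => (hz i).exp) hS
  refine h.congr_deriv ?_
  rw [softmaxJac_mulVec]
  have h2 : softmax (z s) ⬝ᵥ z' = (∑ i, Real.exp (z s i) * z' i) / ∑ i, Real.exp (z s i) := by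
    simp only [dotProduct, softmax, Finset.sum_div]
    exact Finset.sum_congr rfl fun i _ => by ring
  rw [h2, softmax]
  field_simp

theorem hasDerivAt_mulVec {α β : Type*} [Fintype α] [Fintype β] (A : Matrix α β ℝ)
    {z : ℝ → β → ℝ} {z' : β → ℝ} {s : ℝ} (hz : HasDerivAt z z' s) :
    HasDerivAt (fun r => A *ᵥ z r) (A *ᵥ z') s := by
  rw [hasDerivAt_pi] at hz ⊢
  exact fun a => HasDerivAt.fun_sum fun i _ => (hz i).const_mul (A a i)

theorem hasDerivAt_dotProduct {α : Type*} [Fintype α]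
    {x y : ℝ → α → ℝ} {x' y' : α → ℝ} {s : ℝ} (hx : HasDerivAt x x' s) (hy : HasDerivAt y y' s) :
    HasDerivAt (fun r => x r ⬝ᵥ y r) (x' ⬝ᵥ y s + x s ⬝ᵥ y') s := by
  rw [hasDerivAt_pi] at hx hy
  refine (HasDerivAt.fun_sum fun i _ => (hx i).mul (hy i)).congr_deriv ?_
  simp [dotProduct, Finset.sum_add_distrib]

theorem inner_eq_dotProduct (x y : EuclideanSpace ℝ (Fin d)) :
    inner ℝ x y = x.ofLp ⬝ᵥ y.ofLp := by
  rw [EuclideanSpace.inner_eq_star_dotProduct, dotProduct_comm]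
  simp

theorem frobInner_vecMulVec (u w : Fin d → ℝ) (B : Matrix (Fin d) (Fin d) ℝ) :
    frobInner (Matrix.vecMulVec u w) B = u ⬝ᵥ (B *ᵥ w) := by
  simp only [frobInner, Matrix.trace, Matrix.diag, Matrix.mul_apply, Matrix.transpose_apply,
    Matrix.vecMulVec_apply, dotProduct, Matrix.mulVec, Finset.mul_sum]
  rw [Finset.sum_comm]
  exact Finset.sum_congr rfl fun i _ => Finset.sum_congr rfl fun j _ => by ring

theorem frobInner_smul_left (r : ℝ) (A B : Matrix (Fin d) (Fin d) ℝ) :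
    frobInner (r • A) B = r * frobInner A B := by
  simp [frobInner]

theorem hasDerivAt_scores (q : EuclideanSpace ℝ (Fin d)) (X : Matrix (Fin d) (Fin T) ℝ)
    (W B : Matrix (Fin d) (Fin d) ℝ) (s : ℝ) :
    HasDerivAt (fun r : ℝ => scores q X (W + r • B)) (Xᵀ *ᵥ (B *ᵥ q.ofLp)) s := by
  unfold scores
  refine hasDerivAt_mulVec _ ?_
  have h : HasDerivAt (fun r : ℝ => W *ᵥ q.ofLp + r • (B *ᵥ q.ofLp)) ((1 : ℝ) • (B *ᵥ q.ofLp)) s :=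
    ((hasDerivAt_id s).smul_const _).const_add _
  simpa [Matrix.add_mulVec, Matrix.smul_mulVec] using h

/-- The contribution of one head to the directional derivative of the model. -/
theorem hasDerivAt_head {σ : ℝ → ℝ} (hσ : Differentiable ℝ σ) (q : EuclideanSpace ℝ (Fin d))
    (X : Matrix (Fin d) (Fin T) ℝ) (θ ξ : Neuron d) :
    HasDerivAt (fun r : ℝ => (θ + r • ξ).c * feedForward σ q X (θ + r • ξ))
      (ξ.c * featC σ q X θ + θ.c * (inner ℝ (featU σ q X θ) ξ.U + frobInner (featW σ q X θ) ξ.W))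
      0 := by
  have hc : HasDerivAt (fun r : ℝ => (θ + r • ξ).c) ξ.c 0 := by
    have h : HasDerivAt (fun r : ℝ => θ.c + r * ξ.c) (1 * ξ.c) 0 :=
      ((hasDerivAt_id (0 : ℝ)).mul_const ξ.c).const_add θ.c
    simpa [Neuron.c] using h
  have hU : HasDerivAt (fun r : ℝ => (θ + r • ξ).U.ofLp) ξ.U.ofLp 0 := by
    rw [hasDerivAt_pi]
    intro k
    have h : HasDerivAt (fun r : ℝ => θ.U k + r * ξ.U k) (1 * ξ.U k) 0 :=
      ((hasDerivAt_id (0 : ℝ)).mul_const (ξ.U k)).const_add (θ.U k)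
    simpa [Neuron.U] using h
  have hW : ∀ r : ℝ, (θ + r • ξ).W = θ.W + r • ξ.W := by
    intro r; ext k l; simp [Neuron.W]
  have ha := hasDerivAt_mulVec X (hasDerivAt_softmax (hasDerivAt_scores q X θ.W ξ.W 0))
  have hin := hasDerivAt_dotProduct hU ha
  have hs := (hσ (θ.U.ofLp ⬝ᵥ (attn q X θ.W).ofLp)).hasDerivAt
  have h0 : θ.U.ofLp ⬝ᵥ (attn q X θ.W).ofLp = (θ + (0 : ℝ) • ξ).U.ofLp ⬝ᵥ
      (X *ᵥ softmax (scores q X (θ.W + (0 : ℝ) • ξ.W))) := by simp [attn]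
  rw [h0] at hs
  have h := hc.mul (hs.comp 0 hin)
  have e : (fun r : ℝ => (θ + r • ξ).c * feedForward σ q X (θ + r • ξ)) =
      (fun r : ℝ => (θ + r • ξ).c) * (σ ∘ fun r : ℝ => (θ + r • ξ).U.ofLp ⬝ᵥ
        (X *ᵥ softmax (scores q X (θ.W + r • ξ.W)))) := by
    funext r
    simp only [feedForward, inner_eq_dotProduct, attn, hW, Pi.mul_apply, Function.comp]
  rw [e]
  refine h.congr_deriv ?_
  rw [← h0, featC, featU, featW, frobInner_smul_left, frobInner_vecMulVec, real_inner_smul_left,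
    inner_eq_dotProduct, inner_eq_dotProduct]
  -- Symmetry of `M` moves it from `U` onto the variation of the scores, where the chain rule puts
  -- it.
  have h1 : (attnCov q X θ.W *ᵥ θ.U.ofLp) ⬝ᵥ (ξ.W *ᵥ q.ofLp) =
      θ.U.ofLp ⬝ᵥ (X *ᵥ (softmaxJac (scores q X θ.W) *ᵥ (Xᵀ *ᵥ (ξ.W *ᵥ q.ofLp)))) := by
    rw [← Matrix.vecMul_transpose, attnCov_transpose, ← Matrix.dotProduct_mulVec, attnCov]
    simp [Matrix.mulVec_mulVec, Matrix.mul_assoc]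
  rw [h1]
  simp only [zero_smul, add_zero, Function.comp]
  rw [dotProduct_comm (attn q X θ.W).ofLp]
  have h2 : (attn q X θ.W).ofLp = X *ᵥ softmax (scores q X θ.W) := rfl
  rw [h2, dotProduct_comm ξ.U.ofLp]
  ring

theorem differentiable_softmax (t : Fin T) :
    Differentiable ℝ fun z : Fin T → ℝ => softmax z t := by
  simp only [softmax, div_eq_mul_inv]
  have h : Differentiable ℝ fun z : Fin T → ℝ => ∑ s, Real.exp (z s) := by fun_prop
  have h2 : Differentiable ℝ fun z : Fin T → ℝ => Real.exp (z t) := by fun_prop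
  exact h2.fun_mul (h.fun_inv fun z => (sum_exp_pos z t).ne')

theorem differentiable_feedForward {σ : ℝ → ℝ} (hσ : Differentiable ℝ σ)
    (q : EuclideanSpace ℝ (Fin d)) (X : Matrix (Fin d) (Fin T) ℝ) :
    Differentiable ℝ (feedForward σ q X) := by
  unfold feedForward
  have hz : ∀ t, Differentiable ℝ fun θ : Neuron d => scores q X θ.W t := by
    intro t
    simp only [scores, dotProduct, Matrix.mulVec, Neuron.W, Matrix.of_apply]
    fun_prop
  have hp : ∀ t, Differentiable ℝ fun θ : Neuron d => softmax (scores q X θ.W) t := fun t =>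
    (differentiable_softmax t).comp (differentiable_pi.2 hz)
  refine hσ.comp (g := σ) (f := fun θ : Neuron d => inner ℝ θ.U (attn q X θ.W)) ?_
  simp only [inner_eq_dotProduct, attn, dotProduct, Matrix.mulVec]
  refine Differentiable.fun_sum fun k _ => Differentiable.fun_mul ?_ ?_
  · simp only [Neuron.U]
    fun_prop
  · exact Differentiable.fun_sum fun t _ => (hp t).const_mul _

theorem differentiable_model {σ : ℝ → ℝ} (hσ : Differentiable ℝ σ)
    (q : Matrix (Fin d) (Fin T) ℝ → EuclideanSpace ℝ (Fin d)) (X : Matrix (Fin d) (Fin T) ℝ) :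
    Differentiable ℝ (fun φ : Params d m => model σ q X φ) := by
  unfold model
  refine Differentiable.const_mul (Differentiable.fun_sum fun i _ => ?_) _
  refine Differentiable.fun_mul (by unfold Neuron.c; fun_prop) ?_
  exact (differentiable_feedForward hσ (q X) X).comp
    (g := feedForward σ (q X) X) (f := fun φ : Params d m => φ i) (by fun_prop)

/-- Full differentiability identifies the pairing with the gradient as a line derivative; uniqueness
of derivatives then equates it with the sum computed head by head. -/
theorem inner_gradient_model {σ : ℝ → ℝ} (hσ : Differentiable ℝ σ)
    (q : Matrix (Fin d) (Fin T) ℝ → EuclideanSpace ℝ (Fin d)) (X : Matrix (Fin d) (Fin T) ℝ)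
    (φ ξ : Params d m) :
    inner ℝ (gradient (fun ψ : Params d m => model σ q X ψ) φ) ξ =
      1 / √(m : ℝ) * ∑ i, ((ξ i).c * featC σ (q X) X (φ i) + (φ i).c *
        (inner ℝ (featU σ (q X) X (φ i)) (ξ i).U + frobInner (featW σ (q X) X (φ i)) (ξ i).W)) := by
  rw [inner_gradient_left]
  have h1 := (differentiable_model (m := m) hσ q X φ).hasFDerivAt.hasLineDerivAt ξ
  rw [HasLineDerivAt] at h1
  have h2 := (HasDerivAt.fun_sum fun i (_ : i ∈ Finset.univ) =>
      hasDerivAt_head hσ (q X) X (φ i) (ξ i)).const_mul (1 / √(m : ℝ))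
  exact h1.unique h2

end Gradient

/-! ### Pointwise bounds on the random features -/

section Pointwise

variable {d T : ℕ}

/-- The `t`-th token of `X`. -/
def token (X : Matrix (Fin d) (Fin T) ℝ) (t : Fin T) : EuclideanSpace ℝ (Fin d) :=
  WithLp.toLp 2 fun k => X k t

theorem softmax_nonneg (z : Fin T → ℝ) (t : Fin T) : 0 ≤ softmax z t :=
  div_nonneg (Real.exp_pos _).le (sum_exp_pos z t).le

theorem sum_softmax (z : Fin T → ℝ) (t : Fin T) : ∑ s, softmax z s = 1 := by
  simp only [softmax, ← Finset.sum_div]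
  exact div_self (sum_exp_pos z t).ne'

theorem sum_softmax_le_one (z : Fin T → ℝ) : ∑ s, softmax z s ≤ 1 := by
  rcases isEmpty_or_nonempty (Fin T) with h | ⟨⟨t⟩⟩
  · simp
  · exact (sum_softmax z t).le

theorem attn_eq_sum (q : EuclideanSpace ℝ (Fin d)) (X : Matrix (Fin d) (Fin T) ℝ)
    (W : Matrix (Fin d) (Fin d) ℝ) :
    attn q X W = ∑ t, softmax (scores q X W) t • token X t := by
  ext k
  simp [attn, token, Matrix.mulVec, dotProduct, mul_comm]

theorem norm_attn_le_one (q : EuclideanSpace ℝ (Fin d)) {X : Matrix (Fin d) (Fin T) ℝ}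
    (hX : X ∈ inputSpace d T) (W : Matrix (Fin d) (Fin d) ℝ) : ‖attn q X W‖ ≤ 1 := by
  rw [attn_eq_sum]
  refine (norm_sum_le _ _).trans ((Finset.sum_le_sum fun t _ => ?_).trans
    (sum_softmax_le_one (scores q X W)))
  rw [norm_smul, Real.norm_of_nonneg (softmax_nonneg _ t)]
  exact mul_le_of_le_one_right (softmax_nonneg _ t) (hX t)

/-- `M` is the covariance matrix of a token drawn with the attention weights, whose mean is `attn`.
-/
theorem attnCov_mulVec (q : EuclideanSpace ℝ (Fin d)) (X : Matrix (Fin d) (Fin T) ℝ)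
    (W : Matrix (Fin d) (Fin d) ℝ) (U : EuclideanSpace ℝ (Fin d)) :
    WithLp.toLp 2 (attnCov q X W *ᵥ U.ofLp) = ∑ t, (softmax (scores q X W) t *
      inner ℝ (token X t - attn q X W) U) • (token X t - attn q X W) := by
  set p := softmax (scores q X W) with hp
  set a := attn q X W with ha
  have hy : Xᵀ *ᵥ U.ofLp = fun t => inner ℝ (token X t) U := by
    funext t
    simp [inner_eq_dotProduct, Matrix.mulVec, token, Matrix.transpose_apply, dotProduct]
  have ha' : p ⬝ᵥ (Xᵀ *ᵥ U.ofLp) = inner ℝ a U := by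
    rw [hy, ha, attn_eq_sum, sum_inner]
    simp [dotProduct, real_inner_smul_left, hp]
  have h1 : WithLp.toLp 2 (attnCov q X W *ᵥ U.ofLp) =
      ∑ t, (p t * inner ℝ (token X t - a) U) • token X t := by
    ext k
    rw [attnCov, ← Matrix.mulVec_mulVec, ← Matrix.mulVec_mulVec]
    simp only [WithLp.ofLp_sum, Finset.sum_apply, WithLp.ofLp_smul, Pi.smul_apply, smul_eq_mul]
    change (∑ t, X k t * _) = _
    refine Finset.sum_congr rfl fun t _ => ?_
    rw [softmaxJac_mulVec, ← hp, ha', hy, inner_sub_left, mul_comm]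
    rfl
  -- Centred inner products average to zero, so the second factor may be centred as well.
  have h2 : ∑ t, (p t * inner ℝ (token X t - a) U) = 0 := by
    rcases isEmpty_or_nonempty (Fin T) with h | ⟨⟨t⟩⟩
    · simp
    · simp only [inner_sub_left, mul_sub, Finset.sum_sub_distrib, ← Finset.sum_mul]
      rw [hp, sum_softmax _ t, ← hp, ← ha', hy]
      simp [dotProduct]
  simp only [smul_sub, Finset.sum_sub_distrib, ← Finset.sum_smul, h2, zero_smul, sub_zero, h1]

/-- Variance of a token drawn from the attention weights. -/
theorem sum_softmax_mul_norm_sq_le (q : EuclideanSpace ℝ (Fin d)) {X : Matrix (Fin d) (Fin T) ℝ}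
    (hX : X ∈ inputSpace d T) (W : Matrix (Fin d) (Fin d) ℝ) :
    ∑ t, softmax (scores q X W) t * ‖token X t - attn q X W‖ ^ 2 ≤ 1 := by
  rcases isEmpty_or_nonempty (Fin T) with h | ⟨⟨t₀⟩⟩
  · simp
  set p := softmax (scores q X W) with hp
  set a := attn q X W with ha
  have hin : ∑ t, p t * inner ℝ (token X t) a = ‖a‖ ^ 2 := by
    rw [← real_inner_self_eq_norm_sq]
    conv_rhs => rw [ha, attn_eq_sum, sum_inner]
    simp only [real_inner_smul_left]
    rw [ha, ← attn_eq_sum]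
  have hsum : ∑ t, p t = 1 := sum_softmax _ t₀
  have hexp : ∑ t, p t * ‖token X t - a‖ ^ 2 = ∑ t, p t * ‖token X t‖ ^ 2 - ‖a‖ ^ 2 := by
    have : ∀ t, p t * ‖token X t - a‖ ^ 2 =
        p t * ‖token X t‖ ^ 2 - 2 * (p t * inner ℝ (token X t) a) + p t * ‖a‖ ^ 2 := by
      intro t; rw [norm_sub_sq_real]; ring
    simp only [this, Finset.sum_add_distrib, Finset.sum_sub_distrib, ← Finset.mul_sum,
      ← Finset.sum_mul, hin, hsum]
    ring
  have hle : ∑ t, p t * ‖token X t‖ ^ 2 ≤ ∑ t, p t :=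
    Finset.sum_le_sum fun t _ => mul_le_of_le_one_right (softmax_nonneg _ t)
      (pow_le_one₀ (norm_nonneg _) (hX t))
  nlinarith [sq_nonneg ‖a‖]

theorem frobInner_self (B : Matrix (Fin d) (Fin d) ℝ) :
    frobInner B B = ∑ k, ∑ l, B k l ^ 2 := by
  simp only [frobInner, Matrix.trace, Matrix.diag, Matrix.mul_apply, Matrix.transpose_apply, sq]
  exact Finset.sum_comm

theorem norm_mulVec_le_frobNorm (B : Matrix (Fin d) (Fin d) ℝ) (x : EuclideanSpace ℝ (Fin d)) :
    ‖(WithLp.toLp 2 (B *ᵥ x.ofLp) : EuclideanSpace ℝ (Fin d))‖ ≤ frobNorm B * ‖x‖ := by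
  rw [frobNorm, EuclideanSpace.norm_eq, EuclideanSpace.norm_eq, frobInner_self,
    ← Real.sqrt_mul (by positivity), Finset.sum_mul]
  refine Real.sqrt_le_sqrt (Finset.sum_le_sum fun k _ => ?_)
  simp only [Real.norm_eq_abs, sq_abs]
  exact Finset.sum_mul_sq_le_sq_mul_sq Finset.univ (fun l => B k l) (fun l => x l)

/-- The length of `M(X; W) U`. -/
def covNorm (q : EuclideanSpace ℝ (Fin d)) (X : Matrix (Fin d) (Fin T) ℝ) (θ : Neuron d) : ℝ :=
  ‖(WithLp.toLp 2 (attnCov q X θ.W *ᵥ θ.U.ofLp) : EuclideanSpace ℝ (Fin d))‖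

/-- The integrand of `transportFun`. -/
def transportFeature (σ : ℝ → ℝ) (q : EuclideanSpace ℝ (Fin d)) (X : Matrix (Fin d) (Fin T) ℝ)
    (v : Neuron d → Neuron d) (θ : Neuron d) : ℝ :=
  featC σ q X θ * (v θ).c + inner ℝ (featU σ q X θ) (v θ).U + frobInner (featW σ q X θ) (v θ).W

variable {σ : ℝ → ℝ} {σ₀ σ₁ σ₂ νc νu νw : ℝ} {v : Neuron d → Neuron d}
  {q : EuclideanSpace ℝ (Fin d)} {X : Matrix (Fin d) (Fin T) ℝ}

theorem IsBoundedActivation.nonneg (hσ : IsBoundedActivation σ σ₀ σ₁ σ₂) : 0 ≤ σ₀ :=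
  (abs_nonneg _).trans (hσ.abs_le 0)

theorem IsBoundedActivation.deriv_nonneg (hσ : IsBoundedActivation σ σ₀ σ₁ σ₂) : 0 ≤ σ₁ :=
  (abs_nonneg _).trans (hσ.abs_deriv_le 0)

theorem IsBoundedTransport.c_nonneg (hv : IsBoundedTransport v νc νu νw) : 0 ≤ νc :=
  (abs_nonneg _).trans (hv.c_le 0)

theorem IsBoundedTransport.u_nonneg (hv : IsBoundedTransport v νc νu νw) : 0 ≤ νu :=
  (norm_nonneg _).trans (hv.u_le 0)

theorem IsBoundedTransport.w_nonneg (hv : IsBoundedTransport v νc νu νw) : 0 ≤ νw :=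
  (Real.sqrt_nonneg _).trans (hv.w_le 0)

theorem abs_featC_mul_le (hσ : IsBoundedActivation σ σ₀ σ₁ σ₂)
    (hv : IsBoundedTransport v νc νu νw) (θ : Neuron d) :
    |featC σ q X θ * (v θ).c| ≤ σ₀ * νc := by
  rw [abs_mul]
  exact mul_le_mul (hσ.abs_le _) (hv.c_le θ) (abs_nonneg _) hσ.nonneg

theorem abs_inner_featU_le (hσ : IsBoundedActivation σ σ₀ σ₁ σ₂)
    (hv : IsBoundedTransport v νc νu νw) (hX : X ∈ inputSpace d T) (θ : Neuron d) :
    |inner ℝ (featU σ q X θ) (v θ).U| ≤ σ₁ * νu := by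
  refine (abs_real_inner_le_norm _ _).trans
    (mul_le_mul ?_ (hv.u_le θ) (norm_nonneg _) hσ.deriv_nonneg)
  rw [featU, norm_smul]
  exact (mul_le_of_le_one_right (norm_nonneg _) (norm_attn_le_one q hX θ.W)).trans
    (hσ.abs_deriv_le _)

/-- The feature has rank one, so the pairing is `⟨M U, v_w q⟩`, and Cauchy–Schwarz applies. `‖M U‖`
is kept as it stands because it has no uniform bound in `U`. -/
theorem abs_frobInner_featW_le (hσ : IsBoundedActivation σ σ₀ σ₁ σ₂)
    (hv : IsBoundedTransport v νc νu νw) (hq : ‖q‖ ≤ 1) (θ : Neuron d) :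
    |frobInner (featW σ q X θ) (v θ).W| ≤ σ₁ * νw * covNorm q X θ := by
  have h1 : |(attnCov q X θ.W *ᵥ θ.U.ofLp) ⬝ᵥ ((v θ).W *ᵥ q.ofLp)| ≤ covNorm q X θ * νw := by
    have h := abs_real_inner_le_norm
      (WithLp.toLp 2 (attnCov q X θ.W *ᵥ θ.U.ofLp) : EuclideanSpace ℝ (Fin d))
      (WithLp.toLp 2 ((v θ).W *ᵥ q.ofLp))
    rw [inner_eq_dotProduct] at h
    refine h.trans (mul_le_mul_of_nonneg_left ?_ (norm_nonneg _))
    refine (norm_mulVec_le_frobNorm _ _).trans ?_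
    exact (mul_le_of_le_one_right (Real.sqrt_nonneg _) hq).trans (hv.w_le θ)
  rw [featW, frobInner_smul_left, frobInner_vecMulVec, abs_mul]
  calc _ ≤ σ₁ * (covNorm q X θ * νw) :=
        mul_le_mul (hσ.abs_deriv_le _) h1 (abs_nonneg _) hσ.deriv_nonneg
    _ = _ := by ring

theorem abs_transportFeature_le (hσ : IsBoundedActivation σ σ₀ σ₁ σ₂)
    (hv : IsBoundedTransport v νc νu νw) (hX : X ∈ inputSpace d T) (hq : ‖q‖ ≤ 1)
    (θ : Neuron d) :
    |transportFeature σ q X v θ| ≤ σ₀ * νc + σ₁ * νu + σ₁ * νw * covNorm q X θ :=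
  (abs_add_three _ _ _).trans (add_le_add_three (abs_featC_mul_le hσ hv θ)
    (abs_inner_featU_le hσ hv hX θ) (abs_frobInner_featW_le hσ hv hq θ))

theorem convexOn_cosh : ConvexOn ℝ Set.univ Real.cosh := by
  have h := (convexOn_exp.add (convexOn_exp.comp_linearMap (-LinearMap.id))).smul
    (c := (2⁻¹ : ℝ)) (by norm_num)
  refine ConvexOn.congr (by simpa using h) fun x _ => ?_
  simp [Real.cosh_eq]
  ring

/-- Jensen's inequality for `cosh` and a subprobability vector. -/
theorem cosh_le_of_abs_le_sum {ι : Type*} (s : Finset ι) {w g : ι → ℝ} {y : ℝ}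
    (hw : ∀ i ∈ s, 0 ≤ w i) (hw1 : ∑ i ∈ s, w i ≤ 1) (hy : |y| ≤ ∑ i ∈ s, w i * |g i|) :
    Real.cosh y ≤ (1 - ∑ i ∈ s, w i) + ∑ i ∈ s, w i * Real.cosh (g i) := by
  -- The missing mass is placed at `0`, where `cosh` equals `1`.
  have h := convexOn_cosh.map_add_sum_le (t := s) (w := w) (p := fun i => |g i|) (q := 0)
    (v := 1 - ∑ i ∈ s, w i) hw (by ring) (fun _ _ => Set.mem_univ _) (by linarith)
    (Set.mem_univ _)
  simp only [smul_eq_mul, mul_zero, zero_add, Real.cosh_zero, mul_one, Real.cosh_abs] at h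
  refine le_trans ?_ h
  rw [Real.cosh_le_cosh]
  exact hy.trans (le_abs_self _)

/-- Weights for which `M(X; W) U` is dominated by a weighted sum of Gaussians `⟨u_t, U⟩`. -/
theorem exists_weights_covNorm_le (q : EuclideanSpace ℝ (Fin d)) {X : Matrix (Fin d) (Fin T) ℝ}
    (hX : X ∈ inputSpace d T) (W : Matrix (Fin d) (Fin d) ℝ) :
    ∃ (w : Fin T → ℝ) (u : Fin T → EuclideanSpace ℝ (Fin d)), (∀ t, 0 ≤ w t) ∧ ∑ t, w t ≤ 1 ∧
      (∀ t, ‖u t‖ ≤ 1) ∧ ∀ U : EuclideanSpace ℝ (Fin d),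
        ‖(WithLp.toLp 2 (attnCov q X W *ᵥ U.ofLp) : EuclideanSpace ℝ (Fin d))‖ ≤
          ∑ t, w t * |inner ℝ (u t) U| := by
  -- One factor `‖x_t - a‖` comes from the vector and one from normalizing the direction in the
  -- inner product. If `x_t = a`, the convention `0⁻¹ = 0` makes the direction zero.
  refine ⟨fun t => softmax (scores q X W) t * ‖token X t - attn q X W‖ ^ 2,
    fun t => ‖token X t - attn q X W‖⁻¹ • (token X t - attn q X W),
    fun t => mul_nonneg (softmax_nonneg _ t) (sq_nonneg _), sum_softmax_mul_norm_sq_le q hX W,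
    fun t => ?_, fun U => ?_⟩
  · rw [norm_smul, norm_inv, norm_norm]
    exact inv_mul_le_one
  · rw [attnCov_mulVec]
    refine (norm_sum_le _ _).trans (Finset.sum_le_sum fun t _ => le_of_eq ?_)
    rw [norm_smul, Real.norm_eq_abs, abs_mul, abs_of_nonneg (softmax_nonneg _ t),
      real_inner_smul_left, abs_mul, abs_of_nonneg (inv_nonneg.2 (norm_nonneg _))]
    rcases eq_or_ne ‖token X t - attn q X W‖ 0 with h | h
    · simp [h]
    · field_simp

end Pointwise

/-! ### Exponential moments -/

section Moments

variable {d T : ℕ}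

theorem integrable_exp_dotProduct_gaussian (u : Fin d → ℝ) :
    Integrable (fun x => Real.exp (u ⬝ᵥ x)) (Measure.pi fun _ : Fin d => gaussianReal 0 1) := by
  simp only [dotProduct, Real.exp_sum]
  exact Integrable.fintype_prod (f := fun k (y : ℝ) => Real.exp (u k * y))
    fun k => integrable_exp_mul_gaussianReal (u k)

theorem integral_exp_dotProduct_gaussian (u : Fin d → ℝ) :
    ∫ x, Real.exp (u ⬝ᵥ x) ∂(Measure.pi fun _ : Fin d => gaussianReal 0 1) =
      Real.exp ((u ⬝ᵥ u) / 2) := by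
  simp only [dotProduct, Real.exp_sum]
  rw [integral_fintype_prod_eq_prod (fun k (y : ℝ) => Real.exp (u k * y)), Finset.sum_div,
    Real.exp_sum]
  refine Finset.prod_congr rfl fun k _ => ?_
  have h := mgf_gaussianReal (p := gaussianReal 0 1) (X := id) (μ := 0) (v := 1) (by simp) (u k)
  simp only [mgf, id] at h
  rw [h]
  congr 1
  simp
  ring

theorem integrable_cosh_dotProduct_gaussian (u : Fin d → ℝ) :
    Integrable (fun x => Real.cosh (u ⬝ᵥ x)) (Measure.pi fun _ : Fin d => gaussianReal 0 1) := by
  have h := ((integrable_exp_dotProduct_gaussian u).add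
    (integrable_exp_dotProduct_gaussian (-u))).div_const 2
  simpa [Real.cosh_eq] using h

theorem integral_cosh_dotProduct_gaussian (u : Fin d → ℝ) :
    ∫ x, Real.cosh (u ⬝ᵥ x) ∂(Measure.pi fun _ : Fin d => gaussianReal 0 1) =
      Real.exp ((u ⬝ᵥ u) / 2) := by
  have h1 := integrable_exp_dotProduct_gaussian u
  have h2 := integrable_exp_dotProduct_gaussian (-u)
  have h3 := integral_exp_dotProduct_gaussian (-u)
  simp only [neg_dotProduct, dotProduct_neg, neg_neg] at h2 h3
  simp only [Real.cosh_eq]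
  rw [integral_div, integral_add h1 h2, integral_exp_dotProduct_gaussian, h3]
  ring

/-- The moment bound for `M(X; W) U` given `W`, with `U` standard Gaussian. -/
theorem lintegral_cosh_cov_gaussian_le (q : EuclideanSpace ℝ (Fin d))
    {X : Matrix (Fin d) (Fin T) ℝ} (hX : X ∈ inputSpace d T) (W : Matrix (Fin d) (Fin d) ℝ)
    (l : ℝ) :
    ∫⁻ x : Fin d → ℝ, ENNReal.ofReal (Real.cosh (l *
        ‖(WithLp.toLp 2 (attnCov q X W *ᵥ x) : EuclideanSpace ℝ (Fin d))‖))
      ∂(Measure.pi fun _ : Fin d => gaussianReal 0 1) ≤ ENNReal.ofReal (Real.exp (l ^ 2 / 2)) := by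
  obtain ⟨w, u, hw, hw1, hu, hb⟩ := exists_weights_covNorm_le q hX W
  have hcosh : ∀ x : Fin d → ℝ, Real.cosh (l *
        ‖(WithLp.toLp 2 (attnCov q X W *ᵥ x) : EuclideanSpace ℝ (Fin d))‖) ≤
      (1 - ∑ t, w t) + ∑ t, w t * Real.cosh ((l • (u t).ofLp) ⬝ᵥ x) := by
    intro x
    refine cosh_le_of_abs_le_sum Finset.univ (fun t _ => hw t) hw1 ?_
    rw [abs_mul, abs_norm]
    refine (mul_le_mul_of_nonneg_left (hb (WithLp.toLp 2 x)) (abs_nonneg l)).trans (le_of_eq ?_)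
    rw [Finset.mul_sum]
    refine Finset.sum_congr rfl fun t _ => ?_
    rw [smul_dotProduct, smul_eq_mul, abs_mul, inner_eq_dotProduct]
    ring
  have hint : ∀ t, Integrable (fun x => w t * Real.cosh ((l • (u t).ofLp) ⬝ᵥ x))
      (Measure.pi fun _ : Fin d => gaussianReal 0 1) :=
    fun t => (integrable_cosh_dotProduct_gaussian _).const_mul _
  have hint2 := (integrable_const (μ := Measure.pi fun _ : Fin d => gaussianReal 0 1)
    (1 - ∑ t, w t)).add (integrable_finsetSum Finset.univ fun t _ => hint t)
  refine (lintegral_mono fun x => ENNReal.ofReal_le_ofReal (hcosh x)).trans ?_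
  rw [← ofReal_integral_eq_lintegral_ofReal]
  rotate_left
  · simpa using hint2
  · exact Filter.Eventually.of_forall fun x => (Real.cosh_pos _).le.trans (hcosh x)
  refine ENNReal.ofReal_le_ofReal ?_
  rw [integral_add (integrable_const _) (integrable_finsetSum _ fun t _ => hint t),
    integral_finsetSum _ fun t _ => hint t]
  simp only [integral_const, integral_const_mul, integral_cosh_dotProduct_gaussian, probReal_univ,
    smul_eq_mul, one_mul]
  -- The missing mass contributes its own value, which is at most that mass times `exp (l ^ 2 / 2)`;
  -- the total mass is then `1`.
  have h1 : 1 ≤ Real.exp (l ^ 2 / 2) := Real.one_le_exp (by positivity)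
  have h2 : ∑ t, w t * Real.exp ((l • (u t).ofLp) ⬝ᵥ (l • (u t).ofLp) / 2) ≤
      ∑ t, w t * Real.exp (l ^ 2 / 2) := by
    refine Finset.sum_le_sum fun t _ => mul_le_mul_of_nonneg_left (Real.exp_le_exp.2 ?_) (hw t)
    have h3 : (l • (u t).ofLp) ⬝ᵥ (l • (u t).ofLp) = l ^ 2 * ‖u t‖ ^ 2 := by
      rw [smul_dotProduct, dotProduct_smul, ← inner_eq_dotProduct, real_inner_self_eq_norm_sq]
      simp
      ring
    rw [h3]
    have := pow_le_one₀ (n := 2) (norm_nonneg _) (hu t)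
    nlinarith [sq_nonneg l]
  rw [← Finset.sum_mul] at h2
  nlinarith

/-- Integrating out the hidden weights first. -/
theorem lintegral_neuronLaw_le {F : Neuron d → ℝ≥0∞} (hF : Measurable F) {C : ℝ≥0∞}
    (h : ∀ (c : ℝ) (W : Matrix (Fin d) (Fin d) ℝ), ∫⁻ x : Fin d → ℝ,
      F (Neuron.mk c (WithLp.toLp 2 x) W) ∂(Measure.pi fun _ : Fin d => gaussianReal 0 1) ≤ C) :
    ∫⁻ θ, F θ ∂neuronLaw d ≤ C := by
  have hm : Measurable fun y : NeuronIdx d → ℝ => F (WithLp.toLp 2 y) :=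
    hF.comp (WithLp.measurable_toLp 2 _)
  rw [neuronLaw, lintegral_map hF (WithLp.measurable_toLp 2 _)]
  have e1 := measurePreserving_sumPiEquivProdPi_symm (X := fun _ : NeuronIdx d => ℝ) (coordLaw d)
  have e2 := measurePreserving_sumPiEquivProdPi_symm (X := fun _ : Fin d ⊕ (Fin d × Fin d) => ℝ)
    (fun k => coordLaw d (Sum.inr k))
  rw [← e1.lintegral_comp hm]
  refine (lintegral_prod _ (hm.comp e1.measurable).aemeasurable).trans_le ?_
  refine (lintegral_mono (g := fun _ => C) fun c => ?_).trans (by simp)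
  have hm2 := (hm.comp e1.measurable).comp (measurable_prodMk_left (x := c))
  refine (e2.lintegral_comp hm2).symm.trans_le ?_
  -- The symmetric form of Tonelli makes `U` the inner variable, with `W` frozen.
  refine (lintegral_prod_symm _ (hm2.comp e2.measurable).aemeasurable).trans_le ?_
  refine (lintegral_mono (g := fun _ => C) fun W => ?_).trans (by simp)
  refine le_trans (le_of_eq ?_) (h (c ()) (Matrix.of fun k l => W (k, l)))
  refine lintegral_congr fun x => ?_
  simp only [Function.comp]
  congr 2

theorem measurable_mulVec_apply {α β : Type*} [Fintype β] {Ω : Type*} [MeasurableSpace Ω]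
    {A : Ω → Matrix α β ℝ} (hA : ∀ i j, Measurable fun ω => A ω i j) {x : Ω → β → ℝ}
    (hx : ∀ j, Measurable fun ω => x ω j) (i : α) : Measurable fun ω => (A ω *ᵥ x ω) i :=
  Finset.measurable_fun_sum _ fun j _ => (hA i j).mul (hx j)

theorem measurable_scores (q : EuclideanSpace ℝ (Fin d)) (X : Matrix (Fin d) (Fin T) ℝ)
    (t : Fin T) : Measurable fun θ : Neuron d => scores q X θ.W t := by
  simp only [scores, Matrix.mulVec, dotProduct, Neuron.W, Matrix.of_apply]
  fun_prop

theorem measurable_softmax_scores (q : EuclideanSpace ℝ (Fin d)) (X : Matrix (Fin d) (Fin T) ℝ)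
    (t : Fin T) : Measurable fun θ : Neuron d => softmax (scores q X θ.W) t :=
  (differentiable_softmax t).continuous.measurable.comp
    (measurable_pi_lambda _ (measurable_scores q X))

theorem measurable_attn (q : EuclideanSpace ℝ (Fin d)) (X : Matrix (Fin d) (Fin T) ℝ) :
    Measurable fun θ : Neuron d => attn q X θ.W := by
  simp only [attn_eq_sum]
  exact Finset.measurable_fun_sum _ fun t _ => (measurable_softmax_scores q X t).smul_const _

theorem measurable_neuron_c : Measurable (Neuron.c (d := d)) := by
  unfold Neuron.c; fun_prop

theorem measurable_neuron_U : Measurable (Neuron.U (d := d)) := by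
  unfold Neuron.U; fun_prop

theorem measurable_cov (q : EuclideanSpace ℝ (Fin d)) (X : Matrix (Fin d) (Fin T) ℝ) :
    Measurable fun θ : Neuron d =>
      (WithLp.toLp 2 (attnCov q X θ.W *ᵥ θ.U.ofLp) : EuclideanSpace ℝ (Fin d)) := by
  simp only [attnCov_mulVec]
  refine Finset.measurable_fun_sum _ fun t _ => ?_
  have h : Measurable fun θ : Neuron d => token X t - attn q X θ.W :=
    measurable_const.sub (measurable_attn q X)
  exact ((measurable_softmax_scores q X t).mul (h.inner measurable_neuron_U)).smul h

theorem measurable_covNorm (q : EuclideanSpace ℝ (Fin d)) (X : Matrix (Fin d) (Fin T) ℝ) :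
    Measurable (covNorm q X) :=
  (measurable_cov q X).norm

theorem measurable_inner_attn (q : EuclideanSpace ℝ (Fin d)) (X : Matrix (Fin d) (Fin T) ℝ) :
    Measurable fun θ : Neuron d => inner ℝ θ.U (attn q X θ.W) :=
  measurable_neuron_U.inner (measurable_attn q X)

variable {σ : ℝ → ℝ} {v : Neuron d → Neuron d}

theorem measurable_featC_mul (hσ : Measurable σ) (hv : Measurable v)
    (q : EuclideanSpace ℝ (Fin d)) (X : Matrix (Fin d) (Fin T) ℝ) :
    Measurable fun θ => featC σ q X θ * (v θ).c :=
  (hσ.comp (measurable_inner_attn q X)).mul (measurable_neuron_c.comp hv)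

theorem measurable_inner_featU (hv : Measurable v)
    (q : EuclideanSpace ℝ (Fin d)) (X : Matrix (Fin d) (Fin T) ℝ) :
    Measurable fun θ => inner ℝ (featU σ q X θ) (v θ).U :=
  (((measurable_deriv σ).comp (measurable_inner_attn q X)).smul (measurable_attn q X)).inner
    (measurable_neuron_U.comp hv)

theorem measurable_frobInner_featW (hv : Measurable v)
    (q : EuclideanSpace ℝ (Fin d)) (X : Matrix (Fin d) (Fin T) ℝ) :
    Measurable fun θ => frobInner (featW σ q X θ) (v θ).W := by
  simp only [featW, frobInner_smul_left, frobInner_vecMulVec, dotProduct]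
  refine ((measurable_deriv σ).comp (measurable_inner_attn q X)).mul ?_
  refine Finset.measurable_fun_sum _ fun k _ => Measurable.mul ?_ ?_
  · have := measurable_cov q X
    exact (EuclideanSpace.proj (𝕜 := ℝ) k).continuous.measurable.comp this
  · refine measurable_mulVec_apply (A := fun θ => (v θ).W) (x := fun _ => q.ofLp)
      (fun i j => ?_) (fun j => measurable_const) k
    have h : Measurable fun θ : Neuron d => θ.W i j := by
      simp only [Neuron.W, Matrix.of_apply]
      fun_prop
    exact h.comp hv

theorem measurable_transportFeature (hσ : Measurable σ) (hv : Measurable v)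
    (q : EuclideanSpace ℝ (Fin d)) (X : Matrix (Fin d) (Fin T) ℝ) :
    Measurable (transportFeature σ q X v) :=
  ((measurable_featC_mul hσ hv q X).add (measurable_inner_featU hv q X)).add
    (measurable_frobInner_featW hv q X)

/-- The bound is obtained in `ℝ≥0∞` first, where no integrability is required; its finiteness then
supplies integrability. -/
theorem lintegral_cosh_covNorm_le (q : EuclideanSpace ℝ (Fin d))
    {X : Matrix (Fin d) (Fin T) ℝ} (hX : X ∈ inputSpace d T) (l : ℝ) :
    ∫⁻ θ, ENNReal.ofReal (Real.cosh (l * covNorm q X θ)) ∂neuronLaw d ≤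
      ENNReal.ofReal (Real.exp (l ^ 2 / 2)) :=
  lintegral_neuronLaw_le (Real.continuous_cosh.measurable.comp
      (measurable_const.mul (measurable_covNorm q X))).ennreal_ofReal
    fun _ W => lintegral_cosh_cov_gaussian_le q hX W l

theorem integrable_cosh_covNorm (q : EuclideanSpace ℝ (Fin d))
    {X : Matrix (Fin d) (Fin T) ℝ} (hX : X ∈ inputSpace d T) (l : ℝ) :
    Integrable (fun θ => Real.cosh (l * covNorm q X θ)) (neuronLaw d) := by
  refine ⟨(Real.continuous_cosh.measurable.comp
      (measurable_const.mul (measurable_covNorm q X))).aestronglyMeasurable, ?_⟩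
  rw [hasFiniteIntegral_iff_ofReal (Filter.Eventually.of_forall fun θ => (Real.cosh_pos _).le)]
  exact (lintegral_cosh_covNorm_le q hX l).trans_lt ENNReal.ofReal_lt_top

theorem integral_cosh_covNorm_le (q : EuclideanSpace ℝ (Fin d))
    {X : Matrix (Fin d) (Fin T) ℝ} (hX : X ∈ inputSpace d T) (l : ℝ) :
    ∫ θ, Real.cosh (l * covNorm q X θ) ∂neuronLaw d ≤ Real.exp (l ^ 2 / 2) := by
  rw [← ENNReal.ofReal_le_ofReal_iff (Real.exp_pos _).le, ofReal_integral_eq_lintegral_ofReal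
    (integrable_cosh_covNorm q hX l) (Filter.Eventually.of_forall fun θ => (Real.cosh_pos _).le)]
  exact lintegral_cosh_covNorm_le q hX l

theorem integrable_covNorm (q : EuclideanSpace ℝ (Fin d))
    {X : Matrix (Fin d) (Fin T) ℝ} (hX : X ∈ inputSpace d T) :
    Integrable (covNorm q X) (neuronLaw d) := by
  refine ((integrable_cosh_covNorm q hX 1).const_mul 2).mono'
    (measurable_covNorm q X).aestronglyMeasurable (Filter.Eventually.of_forall fun θ => ?_)
  have h0 : 0 ≤ covNorm q X θ := norm_nonneg _
  rw [Real.norm_of_nonneg h0, one_mul, Real.cosh_eq]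
  linarith [Real.add_one_le_exp (covNorm q X θ), Real.exp_pos (-covNorm q X θ)]

end Moments

/-! ### Concentration -/

section Concentration

/-- A variable whose symmetrized moment generating function is sub-Gaussian is sub-Gaussian
after centring, at twice the variance proxy. -/
theorem hasSubgaussianMGF_sub_integral {Ω : Type*} [MeasurableSpace Ω] {μ : Measure Ω}
    [IsProbabilityMeasure μ] {Z : Ω → ℝ} {S : ℝ} (hZ : Integrable Z μ)
    (hint : ∀ l : ℝ, Integrable (fun ω => Real.cosh (l * Z ω)) μ)
    (hle : ∀ l : ℝ, ∫ ω, Real.cosh (l * Z ω) ∂μ ≤ Real.exp (l ^ 2 * S ^ 2 / 2)) :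
    HasSubgaussianMGF (fun ω => Z ω - ∫ x, Z x ∂μ) (Real.toNNReal (2 * S ^ 2)) μ := by
  have hexp : ∀ l : ℝ, Integrable (fun ω => Real.exp (l * Z ω)) μ := by
    intro l
    refine ((hint l).const_mul 2).mono'
      (Real.continuous_exp.comp_aestronglyMeasurable (hZ.aestronglyMeasurable.const_mul l))
      (Filter.Eventually.of_forall fun ω => ?_)
    rw [Real.norm_of_nonneg (Real.exp_pos _).le, Real.cosh_eq]
    linarith [Real.exp_pos (-(l * Z ω))]
  have hsub : ∀ (l : ℝ) (ω : Ω), Real.exp (l * (Z ω - ∫ x, Z x ∂μ)) =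
      Real.exp (l * Z ω) * Real.exp (-l * ∫ x, Z x ∂μ) := by
    intro l ω; rw [← Real.exp_add]; ring_nf
  refine ⟨fun l => ?_, fun l => ?_⟩
  · simp only [hsub]
    exact (hexp l).mul_const _
  · simp only [mgf, hsub, integral_mul_const]
    -- Jensen's inequality replaces the centring factor by the moment generating function at `-l`.
    have hJ : Real.exp (-l * ∫ x, Z x ∂μ) ≤ ∫ x, Real.exp (-l * Z x) ∂μ := by
      rw [← integral_const_mul]
      exact convexOn_exp.map_integral_le Real.continuous_exp.continuousOn isClosed_univ
        (Filter.Eventually.of_forall fun _ => Set.mem_univ _) (hZ.const_mul _) (hexp (-l))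
    have hc : (∫ x, Real.exp (l * Z x) ∂μ + ∫ x, Real.exp (-l * Z x) ∂μ) / 2 =
        ∫ x, Real.cosh (l * Z x) ∂μ := by
      rw [← integral_add (hexp l) (hexp (-l)), ← integral_div]
      simp only [Real.cosh_eq, neg_mul]
    have h0 : 0 ≤ ∫ x, Real.exp (l * Z x) ∂μ := integral_nonneg fun _ => (Real.exp_pos _).le
    have h0' : 0 ≤ ∫ x, Real.cosh (l * Z x) ∂μ := integral_nonneg fun _ => (Real.cosh_pos _).le
    calc (∫ x, Real.exp (l * Z x) ∂μ) * Real.exp (-l * ∫ x, Z x ∂μ)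
        ≤ (∫ x, Real.exp (l * Z x) ∂μ) * ∫ x, Real.exp (-l * Z x) ∂μ :=
          mul_le_mul_of_nonneg_left hJ h0
      -- The two exponential moments have arithmetic mean `E cosh (l Z)`, so AM–GM bounds their
      -- product by its square. This square is what doubles the variance proxy.
      _ ≤ (∫ x, Real.cosh (l * Z x) ∂μ) ^ 2 := by
          rw [← hc]
          nlinarith [sq_nonneg (∫ x, Real.exp (l * Z x) ∂μ - ∫ x, Real.exp (-l * Z x) ∂μ)]
      _ ≤ Real.exp (l ^ 2 * S ^ 2 / 2) ^ 2 := pow_le_pow_left₀ h0' (hle l) 2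
      _ = _ := by
          rw [← Real.exp_nat_mul, Real.coe_toNNReal _ (by positivity)]
          congr 1
          push_cast
          ring

/-- Two-sided Hoeffding bound for the sum of `N` independent copies of a variable. -/
theorem measureReal_lt_abs_sum_le {Ω : Type*} [MeasurableSpace Ω] {μ : Measure Ω}
    [IsProbabilityMeasure μ] {Y : Ω → ℝ} {c : NNReal} (hY : HasSubgaussianMGF Y c μ) (N : ℕ)
    {ε : ℝ} (hε : 0 ≤ ε) :
    (Measure.pi fun _ : Fin N => μ).real {ω | ε < |∑ i, Y (ω i)|} ≤
      2 * Real.exp (-ε ^ 2 / (2 * (N * c))) := by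
  have key : ∀ Y' : Ω → ℝ, HasSubgaussianMGF Y' c μ →
      (Measure.pi fun _ : Fin N => μ).real {ω | ε ≤ ∑ i, Y' (ω i)} ≤
        Real.exp (-ε ^ 2 / (2 * (N * c))) := by
    intro Y' hY'
    have hind : iIndepFun (fun (i : Fin N) (ω : Fin N → Ω) => Y' (ω i))
        (Measure.pi fun _ : Fin N => μ) := iIndepFun_pi fun _ => hY'.aemeasurable
    have hsg : ∀ i ∈ (Finset.univ : Finset (Fin N)), HasSubgaussianMGF
        (fun ω : Fin N → Ω => Y' (ω i)) c (Measure.pi fun _ : Fin N => μ) := by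
      intro i _
      have hmp := measurePreserving_eval (fun _ : Fin N => μ) i
      refine HasSubgaussianMGF.of_map (Y := Function.eval i) (X := Y')
        hmp.measurable.aemeasurable ?_
      rwa [hmp.map_eq]
    simpa using HasSubgaussianMGF.measure_sum_ge_le_of_iIndepFun hind hsg hε
  have hsub : {ω : Fin N → Ω | ε < |∑ i, Y (ω i)|} ⊆
      {ω | ε ≤ ∑ i, Y (ω i)} ∪ {ω | ε ≤ ∑ i, (-Y) (ω i)} := by
    intro ω hω
    simp only [Set.mem_ofPred_eq, lt_abs] at hω
    simp only [Set.mem_union, Set.mem_ofPred_eq, Pi.neg_apply, Finset.sum_neg_distrib]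
    exact hω.imp le_of_lt le_of_lt
  refine (measureReal_mono hsub).trans ((measureReal_union_le _ _).trans ?_)
  linarith [key Y hY, key (-Y) hY.neg]

variable {d T : ℕ} {σ : ℝ → ℝ} {σ₀ σ₁ σ₂ νc νu νw : ℝ} {v : Neuron d → Neuron d}
  {q : EuclideanSpace ℝ (Fin d)} {X : Matrix (Fin d) (Fin T) ℝ}

/-- `Z` is dominated by an affine function of the length of `M(X; W) U`, hence has
sub-Gaussian symmetrized moments. -/
theorem cosh_moment_of_abs_le_covNorm (hX : X ∈ inputSpace d T) {Z : Neuron d → ℝ}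
    (hZm : Measurable Z) {A B : ℝ} (hA : 0 ≤ A) (hB : 0 ≤ B)
    (hZ : ∀ θ, |Z θ| ≤ A + B * covNorm q X θ) (l : ℝ) :
    Integrable (fun θ => Real.cosh (l * Z θ)) (neuronLaw d) ∧
      ∫ θ, Real.cosh (l * Z θ) ∂neuronLaw d ≤ Real.exp (l ^ 2 * (A + B) ^ 2 / 2) := by
  rcases (add_nonneg hA hB).eq_or_lt with h0 | hS
  · have hA0 : A = 0 := by linarith
    have hB0 : B = 0 := by linarith
    have hZ0 : ∀ θ, Z θ = 0 := fun θ => by simpa [hA0, hB0] using hZ θ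
    simp [hZ0, hA0, hB0]
  have hbound : ∀ θ, Real.cosh (l * Z θ) ≤ A / (A + B) * Real.cosh (l * (A + B)) +
      B / (A + B) * Real.cosh (l * (A + B) * covNorm q X θ) := by
    intro θ
    have hn : 0 ≤ covNorm q X θ := norm_nonneg _
    -- With `S = A + B`, the bound on `|l Z|` is a convex combination, with weights `A / S` and `B /
    -- S`, of `|l| S` and `|l| S ‖M U‖`. The case `S = 0` was removed so that these weights make
    -- sense.
    have h := cosh_le_of_abs_le_sum (Finset.univ : Finset (Fin 2)) (w := ![A / (A + B), B / (A + B)])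
      (g := ![l * (A + B), l * (A + B) * covNorm q X θ]) (y := l * Z θ) ?_ ?_ ?_
    · simp only [Fin.sum_univ_two, Matrix.cons_val_zero, Matrix.cons_val_one] at h
      have e : A / (A + B) + B / (A + B) = 1 := by field_simp
      linarith
    · intro i _
      fin_cases i
      · exact div_nonneg hA hS.le
      · exact div_nonneg hB hS.le
    · simp only [Fin.sum_univ_two, Matrix.cons_val_zero, Matrix.cons_val_one]
      rw [← add_div, div_self hS.ne']
    · simp only [Fin.sum_univ_two, Matrix.cons_val_zero, Matrix.cons_val_one, abs_mul,
        abs_of_pos hS, abs_of_nonneg hn]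
      refine (mul_le_mul_of_nonneg_left (hZ θ) (abs_nonneg l)).trans (le_of_eq ?_)
      field_simp
  have hI := integrable_cosh_covNorm q hX (l * (A + B))
  have hI2 := (integrable_const (μ := neuronLaw d) (A / (A + B) * Real.cosh (l * (A + B)))).add
    (hI.const_mul (B / (A + B)))
  have hint : Integrable (fun θ => Real.cosh (l * Z θ)) (neuronLaw d) := by
    refine hI2.mono' (Real.continuous_cosh.measurable.comp
      (hZm.const_mul l)).aestronglyMeasurable (Filter.Eventually.of_forall fun θ => ?_)
    rw [Real.norm_of_nonneg (Real.cosh_pos _).le]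
    exact hbound θ
  refine ⟨hint, (integral_mono hint hI2 hbound).trans ?_⟩
  simp only [Pi.add_apply]
  rw [integral_add (integrable_const _) (hI.const_mul _)]
  simp only [integral_const, integral_const_mul, probReal_univ, smul_eq_mul, one_mul]
  have h1 : Real.cosh (l * (A + B)) ≤ Real.exp (l ^ 2 * (A + B) ^ 2 / 2) := by
    rw [← mul_pow]; exact Real.cosh_le_exp_half_sq _
  have h2 : ∫ θ, Real.cosh (l * (A + B) * covNorm q X θ) ∂neuronLaw d ≤
      Real.exp (l ^ 2 * (A + B) ^ 2 / 2) := by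
    rw [← mul_pow]; exact integral_cosh_covNorm_le q hX _
  calc _ ≤ A / (A + B) * Real.exp (l ^ 2 * (A + B) ^ 2 / 2) +
        B / (A + B) * Real.exp (l ^ 2 * (A + B) ^ 2 / 2) :=
        add_le_add (mul_le_mul_of_nonneg_left h1 (div_nonneg hA hS.le))
          (mul_le_mul_of_nonneg_left h2 (div_nonneg hB hS.le))
    _ = _ := by rw [← add_mul, ← add_div, div_self hS.ne', one_mul]

theorem integrable_of_abs_le_covNorm (hX : X ∈ inputSpace d T) {Z : Neuron d → ℝ}
    (hZm : Measurable Z) {A B : ℝ} (hZ : ∀ θ, |Z θ| ≤ A + B * covNorm q X θ) :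
    Integrable Z (neuronLaw d) :=
  ((integrable_const A).add ((integrable_covNorm q hX).const_mul B)).mono'
    hZm.aestronglyMeasurable (Filter.Eventually.of_forall hZ)

/-- Concentration of the average of `N` independent copies of `Z`, with `m = 2 N`. -/
theorem measureReal_average_le (hX : X ∈ inputSpace d T) {Z : Neuron d → ℝ}
    (hZm : Measurable Z) {A B : ℝ} (hA : 0 ≤ A) (hB : 0 ≤ B)
    (hZ : ∀ θ, |Z θ| ≤ A + B * covNorm q X θ) {N : ℕ} (hN : 0 < N) {L : ℝ} (hL : 0 ≤ L) :
    (Measure.pi fun _ : Fin N => neuronLaw d).real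
      {θ | 2 * (A + B) * √(2 * L / (2 * N)) <
        |(1 / N : ℝ) * ∑ i, Z (θ i) - ∫ x, Z x ∂neuronLaw d|} ≤ 2 * Real.exp (-L) := by
  have hN' : (0 : ℝ) < N := by exact_mod_cast hN
  rcases (add_nonneg hA hB).eq_or_lt with h0 | hS
  · have hA0 : A = 0 := by linarith
    have hB0 : B = 0 := by linarith
    have hZ0 : ∀ θ, Z θ = 0 := fun θ => by simpa [hA0, hB0] using hZ θ
    simp [hZ0, hA0, hB0, Real.exp_nonneg]
  have hsg := hasSubgaussianMGF_sub_integral (S := A + B)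
    (integrable_of_abs_le_covNorm hX hZm hZ)
    (fun l => (cosh_moment_of_abs_le_covNorm hX hZm hA hB hZ l).1)
    (fun l => (cosh_moment_of_abs_le_covNorm hX hZm hA hB hZ l).2)
  have h := measureReal_lt_abs_sum_le hsg N (ε := N * (2 * (A + B) * √(2 * L / (2 * N))))
    (by positivity)
  -- Here `ε² = 4 N S² L`, while the denominator is `2 N (2 S²)`.
  have hexp : -(N * (2 * (A + B) * √(2 * L / (2 * N)))) ^ 2 /
      (2 * (N * (Real.toNNReal (2 * (A + B) ^ 2) : ℝ))) = -L := by
    rw [Real.coe_toNNReal _ (by positivity), mul_pow, mul_pow, Real.sq_sqrt (by positivity)]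
    field_simp
  rw [hexp] at h
  refine le_trans (measureReal_mono fun θ hθ => ?_) h
  simp only [Set.mem_ofPred_eq] at hθ ⊢
  have e : ∑ i, (Z (θ i) - ∫ x, Z x ∂neuronLaw d) =
      N * ((1 / N : ℝ) * ∑ i, Z (θ i) - ∫ x, Z x ∂neuronLaw d) := by
    simp only [Finset.sum_sub_distrib, Finset.sum_const, Finset.card_univ, Fintype.card_fin,
      nsmul_eq_mul]
    field_simp
  rw [e, abs_mul, abs_of_pos hN']
  exact mul_lt_mul_of_pos_left hθ hN'

end Concentration

/-! ### Symmetric initialization -/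

section Initialization

variable {d T m : ℕ}

theorem measurePreserving_neg_rademacher : MeasurePreserving (fun x : ℝ => -x) rademacher rademacher := by
  refine ⟨measurable_neg, ?_⟩
  rw [rademacher, Measure.map_add _ _ measurable_neg, Measure.map_smul, Measure.map_smul,
    Measure.map_dirac' measurable_neg, Measure.map_dirac' measurable_neg, neg_neg, add_comm]

/-- The flip acts coordinatewise on a product law and changes only the Rademacher coordinate, whose
law is symmetric. -/
theorem measurePreserving_flip :
    MeasurePreserving (Neuron.flip (d := d)) (neuronLaw d) (neuronLaw d) := by
  have htoLp : MeasurePreserving (WithLp.toLp 2) (Measure.pi (coordLaw d)) (neuronLaw d) :=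
    ⟨WithLp.measurable_toLp 2 _, rfl⟩
  let f : NeuronIdx d → ℝ → ℝ := Sum.elim (fun _ x => -x) fun _ x => x
  have hf : ∀ k, MeasurePreserving (f k) (coordLaw d k) (coordLaw d k) := by
    rintro (k | k)
    · exact measurePreserving_neg_rademacher
    · exact MeasurePreserving.id _
  have hpi := measurePreserving_pi (coordLaw d) (coordLaw d) hf
  have hcomp : Neuron.flip ∘ WithLp.toLp 2 =
      (WithLp.toLp 2 : (NeuronIdx d → ℝ) → Neuron d) ∘ fun y k => f k (y k) := by
    funext y
    ext k
    rcases k with k | k | k <;> rfl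
  refine ⟨Neuron.measurable_flip, ?_⟩
  conv_lhs => rw [neuronLaw, Measure.map_map Neuron.measurable_flip htoLp.measurable, hcomp]
  exact (htoLp.comp hpi).map_eq

theorem ae_c_sq_eq_one : ∀ᵐ θ ∂neuronLaw d, θ.c ^ 2 = 1 := by
  have hm : MeasurableSet {θ : Neuron d | θ.c ^ 2 = 1} :=
    measurableSet_eq_fun (measurable_neuron_c.pow_const 2) measurable_const
  rw [neuronLaw, ae_map_iff (WithLp.measurable_toLp 2 _).aemeasurable hm]
  have hr : ∀ᵐ x ∂coordLaw d (Sum.inl ()), x ^ 2 = 1 := by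
    have hm' : MeasurableSet {x : ℝ | x ^ 2 = 1} :=
      measurableSet_eq_fun (measurable_id.pow_const 2) measurable_const
    change ∀ᵐ x ∂rademacher, x ^ 2 = 1
    rw [rademacher, ae_add_measure_iff]
    exact ⟨Measure.ae_smul_measure ((ae_dirac_iff hm').2 (by norm_num)) _,
      Measure.ae_smul_measure ((ae_dirac_iff hm').2 (by norm_num)) _⟩
  exact (measurePreserving_eval (coordLaw d) (Sum.inl ())).quasiMeasurePreserving.ae hr

/-- Summation over the heads of a mirrored parameter, pairing each head with its mirror image. -/
theorem sum_mirror (hm : Even m) (θ : Fin (m / 2) → Neuron d) (F : Neuron d → ℝ) :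
    ∑ i, F (mirror hm θ i) = ∑ i, (F (θ i) + F (θ i).flip) := by
  have hm2 : m / 2 + m / 2 = m := by
    obtain ⟨k, rfl⟩ := hm
    omega
  rw [← Equiv.sum_comp (finSumFinEquiv.trans (finCongr hm2)), Fintype.sum_sum_type,
    Finset.sum_add_distrib]
  congr 1
  · refine Finset.sum_congr rfl fun i _ => ?_
    simp [mirror]
  · refine Finset.sum_congr rfl fun i _ => ?_
    simp [mirror]

theorem feedForward_flip (σ : ℝ → ℝ) (q : EuclideanSpace ℝ (Fin d))
    (X : Matrix (Fin d) (Fin T) ℝ) (θ : Neuron d) :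
    feedForward σ q X θ.flip = feedForward σ q X θ := rfl

theorem covNorm_flip (q : EuclideanSpace ℝ (Fin d))
    (X : Matrix (Fin d) (Fin T) ℝ) (θ : Neuron d) : covNorm q X θ.flip = covNorm q X θ := rfl

theorem model_mirror (σ : ℝ → ℝ) (q : Matrix (Fin d) (Fin T) ℝ → EuclideanSpace ℝ (Fin d))
    (X : Matrix (Fin d) (Fin T) ℝ) (hm : Even m) (θ : Fin (m / 2) → Neuron d) :
    model σ q X (mirror hm θ) = 0 := by
  rw [model, sum_mirror hm θ fun θ => θ.c * feedForward σ (q X) X θ]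
  have h : ∀ θ : Neuron d, θ.flip.c = -θ.c := fun θ => rfl
  simp [feedForward_flip, h]

/-- The average of `transportFeature` over a head and its mirror image. -/
def mirroredFeature (σ : ℝ → ℝ) (q : EuclideanSpace ℝ (Fin d)) (X : Matrix (Fin d) (Fin T) ℝ)
    (v : Neuron d → Neuron d) (θ : Neuron d) : ℝ :=
  (transportFeature σ q X v θ + transportFeature σ q X v θ.flip) / 2

theorem inner_gradient_transported {σ : ℝ → ℝ} (hσ : Differentiable ℝ σ)
    (q : Matrix (Fin d) (Fin T) ℝ → EuclideanSpace ℝ (Fin d)) (X : Matrix (Fin d) (Fin T) ℝ)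
    (v : Neuron d → Neuron d) (φ : Params d m) (hφ : ∀ i, (φ i).c ^ 2 = 1) :
    inner ℝ (gradient (fun ψ : Params d m => model σ q X ψ) φ) (transported v φ - φ) =
      1 / m * ∑ i, transportFeature σ (q X) X v (φ i) := by
  rw [inner_gradient_model hσ]
  have hc : ∀ i, ((transported v φ - φ) i).c = 1 / √(m : ℝ) * (v (φ i)).c := by
    intro i
    simp [transported, Neuron.c, Neuron.mk]
  have hU : ∀ i, ((transported v φ - φ) i).U = ((φ i).c * (1 / √(m : ℝ))) • (v (φ i)).U := by
    intro i
    ext k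
    simp [transported, Neuron.U, Neuron.mk]
  have hW : ∀ i, ((transported v φ - φ) i).W = ((φ i).c * (1 / √(m : ℝ))) • (v (φ i)).W := by
    intro i
    ext k l
    simp [transported, Neuron.W, Neuron.mk]
  have hterm : ∀ i, ((transported v φ - φ) i).c * featC σ (q X) X (φ i) + (φ i).c *
        (inner ℝ (featU σ (q X) X (φ i)) ((transported v φ - φ) i).U +
          frobInner (featW σ (q X) X (φ i)) ((transported v φ - φ) i).W) =
      1 / √(m : ℝ) * transportFeature σ (q X) X v (φ i) := by
    intro i
    have hs : ∀ (r : ℝ) (A B : Matrix (Fin d) (Fin d) ℝ),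
        frobInner A (r • B) = r * frobInner A B := fun r A B => by simp [frobInner]
    rw [hc, hU, hW, real_inner_smul_right, hs, transportFeature]
    linear_combination (1 / √(m : ℝ) * (inner ℝ (featU σ (q X) X (φ i)) (v (φ i)).U +
      frobInner (featW σ (q X) X (φ i)) (v (φ i)).W)) * hφ i
  rw [Finset.sum_congr rfl fun i _ => hterm i, ← Finset.mul_sum, ← mul_assoc,
    div_mul_div_comm, Real.mul_self_sqrt (Nat.cast_nonneg m), one_mul]

/-- At a mirrored initialization the linearized model of the transported parameters is an
average of independent random features. -/
theorem linModel_mirror {σ : ℝ → ℝ} (hσ : Differentiable ℝ σ)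
    (q : Matrix (Fin d) (Fin T) ℝ → EuclideanSpace ℝ (Fin d)) (X : Matrix (Fin d) (Fin T) ℝ)
    (v : Neuron d → Neuron d) (hm : Even m) (θ : Fin (m / 2) → Neuron d)
    (hθ : ∀ i, (θ i).c ^ 2 = 1) :
    linModel σ q (mirror hm θ) X (transported v (mirror hm θ)) =
      1 / ((m / 2 : ℕ) : ℝ) * ∑ i, mirroredFeature σ (q X) X v (θ i) := by
  have hφ : ∀ i, (mirror hm θ i).c ^ 2 = 1 := by
    intro i
    simp only [mirror]
    split_ifs
    · exact hθ _
    · simpa [Neuron.flip] using hθ _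
  have hm2 : (m : ℝ) = 2 * ((m / 2 : ℕ) : ℝ) := by
    exact_mod_cast (Nat.two_mul_div_two_of_even hm).symm
  rw [linModel, model_mirror, zero_add, inner_gradient_transported hσ q X v _ hφ,
    sum_mirror hm θ (transportFeature σ (q X) X v), hm2]
  simp only [mirroredFeature, ← Finset.sum_div]
  ring

variable {σ : ℝ → ℝ} {σ₀ σ₁ σ₂ νc νu νw : ℝ} {v : Neuron d → Neuron d}

theorem abs_mirroredFeature_le {q : EuclideanSpace ℝ (Fin d)} {X : Matrix (Fin d) (Fin T) ℝ}
    (hσ : IsBoundedActivation σ σ₀ σ₁ σ₂)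
    (hv : IsBoundedTransport v νc νu νw) (hX : X ∈ inputSpace d T) (hq : ‖q‖ ≤ 1)
    (θ : Neuron d) :
    |mirroredFeature σ q X v θ| ≤ σ₀ * νc + σ₁ * νu + σ₁ * νw * covNorm q X θ := by
  have h1 := abs_le.1 (abs_transportFeature_le hσ hv hX hq θ)
  have h2 := abs_le.1 (abs_transportFeature_le hσ hv hX hq θ.flip)
  rw [covNorm_flip] at h2
  rw [mirroredFeature, abs_le]
  constructor <;> linarith [h1.1, h1.2, h2.1, h2.2]

theorem measurable_mirroredFeature (hσ : Measurable σ) (hv : Measurable v)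
    (q : EuclideanSpace ℝ (Fin d)) (X : Matrix (Fin d) (Fin T) ℝ) :
    Measurable (mirroredFeature σ q X v) := by
  have h := measurable_transportFeature hσ hv q X
  exact (h.add (h.comp Neuron.measurable_flip)).div_const 2

/-- Since `v` may depend on `c`, a head and its mirror image can have different features, but flip
invariance gives them the same mean. -/
theorem integral_mirroredFeature (hσ : IsBoundedActivation σ σ₀ σ₁ σ₂)
    (hv : IsBoundedTransport v νc νu νw)
    {q : Matrix (Fin d) (Fin T) ℝ → EuclideanSpace ℝ (Fin d)} {X : Matrix (Fin d) (Fin T) ℝ}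
    (hX : X ∈ inputSpace d T) (hq : ‖q X‖ ≤ 1) :
    ∫ θ, mirroredFeature σ (q X) X v θ ∂neuronLaw d = transportFun σ q v X := by
  have hσm : Measurable σ := hσ.differentiable.continuous.measurable
  have hc : Integrable (fun θ => featC σ (q X) X θ * (v θ).c) (neuronLaw d) :=
    integrable_of_abs_le_covNorm (q := q X) (A := σ₀ * νc) (B := 0) hX
      (measurable_featC_mul hσm hv.measurable _ _) fun θ => by
        simpa using abs_featC_mul_le hσ hv θ
  have hu : Integrable (fun θ => inner ℝ (featU σ (q X) X θ) (v θ).U) (neuronLaw d) :=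
    integrable_of_abs_le_covNorm (q := q X) (A := σ₁ * νu) (B := 0) hX
      (measurable_inner_featU hv.measurable _ _) fun θ => by
        simpa using abs_inner_featU_le hσ hv hX θ
  have hw : Integrable (fun θ => frobInner (featW σ (q X) X θ) (v θ).W) (neuronLaw d) :=
    integrable_of_abs_le_covNorm (q := q X) (A := 0) (B := σ₁ * νw) hX
      (measurable_frobInner_featW hv.measurable _ _) fun θ => by
        simpa using abs_frobInner_featW_le hσ hv hq θ
  have hY : Integrable (transportFeature σ (q X) X v) (neuronLaw d) := (hc.add hu).add hw
  have hflip : ∫ θ, transportFeature σ (q X) X v θ.flip ∂neuronLaw d =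
      ∫ θ, transportFeature σ (q X) X v θ ∂neuronLaw d := by
    conv_rhs => rw [← measurePreserving_flip.map_eq]
    rw [integral_map Neuron.measurable_flip.aemeasurable
      (measurable_transportFeature hσm hv.measurable _ _).aestronglyMeasurable]
  simp only [mirroredFeature]
  have hYf : Integrable (fun θ => transportFeature σ (q X) X v θ.flip) (neuronLaw d) :=
    measurePreserving_flip.integrable_comp_of_integrable hY
  rw [integral_div, integral_add hY hYf, hflip, add_self_div_two]
  rw [transportFun, ← integral_add hc hu]
  exact integral_add (hc.add hu) hw

end Initialization

/-! ### Approximation by transportation -/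

section Approximation

variable {d T m n : ℕ} {σ : ℝ → ℝ} {σ₀ σ₁ σ₂ νc νu νw : ℝ} {v : Neuron d → Neuron d}

/-- The mirrored features concentrate simultaneously at all inputs. -/
theorem measureReal_exists_mirroredFeature_le {N : ℕ} (hN : 0 < N) (hn : 0 < n)
    (hσ : IsBoundedActivation σ σ₀ σ₁ σ₂) (q : Matrix (Fin d) (Fin T) ℝ → EuclideanSpace ℝ (Fin d))
    (hq : ∀ X ∈ inputSpace d T, ‖q X‖ ≤ 1)
    (X : Fin n → Matrix (Fin d) (Fin T) ℝ) (hX : ∀ j, X j ∈ inputSpace d T)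
    (hv : IsBoundedTransport v νc νu νw) {δ : ℝ} (hδ : δ ∈ Set.Ioo (0 : ℝ) 1) :
    (Measure.pi fun _ : Fin N => neuronLaw d).real
      {θ | ∃ j, 2 * (σ₀ * νc + σ₁ * νu + σ₁ * νw) * √(2 * Real.log (2 * n / δ) / (2 * N)) <
        |(1 / N : ℝ) * ∑ i, mirroredFeature σ (q (X j)) (X j) v (θ i) -
          transportFun σ q v (X j)|} ≤ δ := by
  have hn1 : (1 : ℝ) ≤ n := by exact_mod_cast hn
  have hpos : 0 < 2 * n / δ := div_pos (by linarith) hδ.1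
  have hL : 0 ≤ Real.log (2 * n / δ) := by
    refine Real.log_nonneg ?_
    rw [le_div_iff₀ hδ.1]
    linarith [hδ.2]
  have hj : ∀ j, (Measure.pi fun _ : Fin N => neuronLaw d).real
      {θ | 2 * (σ₀ * νc + σ₁ * νu + σ₁ * νw) * √(2 * Real.log (2 * n / δ) / (2 * N)) <
        |(1 / N : ℝ) * ∑ i, mirroredFeature σ (q (X j)) (X j) v (θ i) -
          transportFun σ q v (X j)|} ≤ δ / n := by
    intro j
    have hqj := hq _ (hX j)
    have h := measureReal_average_le (hX j) (measurable_mirroredFeature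
      hσ.differentiable.continuous.measurable hv.measurable (q (X j)) (X j))
      (add_nonneg (mul_nonneg hσ.nonneg hv.c_nonneg) (mul_nonneg hσ.deriv_nonneg hv.u_nonneg))
      (mul_nonneg hσ.deriv_nonneg hv.w_nonneg)
      (abs_mirroredFeature_le hσ hv (hX j) hqj) hN hL
    rw [integral_mirroredFeature hσ hv (hX j) hqj] at h
    refine h.trans (le_of_eq ?_)
    -- The choice of `L` gives `2 exp (-L) = δ / n`, an equal share of `δ` for each input.
    rw [Real.exp_neg, Real.exp_log hpos]
    field_simp
  have hU := measureReal_iUnion_fintype_le (μ := Measure.pi fun _ : Fin N => neuronLaw d)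
    fun j : Fin n => {θ : Fin N → Neuron d |
      2 * (σ₀ * νc + σ₁ * νu + σ₁ * νw) * √(2 * Real.log (2 * n / δ) / (2 * N)) <
        |(1 / N : ℝ) * ∑ i, mirroredFeature σ (q (X j)) (X j) v (θ i) -
          transportFun σ q v (X j)|}
  rw [← Set.ofPred_exists] at hU
  refine hU.trans ((Finset.sum_le_sum fun j _ => hj j).trans (le_of_eq ?_))
  simp only [Finset.sum_const, Finset.card_univ, Fintype.card_fin, nsmul_eq_mul]
  field_simp

/-- Probabilities of events of the independent heads transfer to the mirrored parameters. -/
theorem measure_le_of_mirror {Ω : Type*} [MeasurableSpace Ω] {P : Measure Ω} (hm : Even m)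
    {φ₀ : Ω → Params d m} (hφ₀ : HasLaw φ₀ (symmetricInitLaw d hm) P)
    {G : Set (Fin (m / 2) → Neuron d)} (hG : MeasurableSet G) {S : Set (Params d m)}
    (hGS : ∀ θ ∈ G, mirror hm θ ∈ S) :
    (Measure.pi fun _ : Fin (m / 2) => neuronLaw d) G ≤ P {ω | φ₀ ω ∈ S} := by
  let r : Params d m → Fin (m / 2) → Neuron d := fun φ i => φ ⟨i, by omega⟩
  have hr : Measurable r := by
    refine measurable_pi_lambda _ fun i => ?_
    exact (measurable_pi_apply _).comp (WithLp.measurable_ofLp 2 _)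
  have hrm : ∀ θ, r (mirror hm θ) = θ := by
    intro θ
    funext i
    simp [r, mirror]
  -- `S` need not be measurable, so the law is applied to a measurable subset of it: the mirrored
  -- parameters whose first half, extracted by `r`, lies in `G`.
  have hD : MeasurableSet {φ : Params d m | mirror hm (r φ) = φ ∧ r φ ∈ G} :=
    (measurableSet_eq_fun ((measurable_mirror hm).comp hr) measurable_id).inter (hr hG)
  calc (Measure.pi fun _ : Fin (m / 2) => neuronLaw d) G
      = symmetricInitLaw d hm {φ : Params d m | mirror hm (r φ) = φ ∧ r φ ∈ G} := by
        rw [symmetricInitLaw, Measure.map_apply (measurable_mirror hm) hD]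
        congr 1
        ext θ
        simp [hrm]
    _ = P {ω | mirror hm (r (φ₀ ω)) = φ₀ ω ∧ r (φ₀ ω) ∈ G} := (hφ₀.measure_eq hD).symm
    _ ≤ P {ω | φ₀ ω ∈ S} := by
        refine measure_mono fun ω hω => ?_
        have h := hGS _ hω.2
        rwa [hω.1] at h

end Approximation

end ShallowTransformer

end

open ShallowTransformer
theorem mainTheorem3 {d T m n : ℕ} (hm : Even m) (hm_pos : 0 < m) (hn : 0 < n)
    {σ : ℝ → ℝ} {σ₀ σ₁ σ₂ : ℝ} (hσ : IsBoundedActivation σ σ₀ σ₁ σ₂)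
    (q : Matrix (Fin d) (Fin T) ℝ → EuclideanSpace ℝ (Fin d))
    (hq : ∀ X ∈ inputSpace d T, ‖q X‖ ≤ 1)
    (X : Fin n → Matrix (Fin d) (Fin T) ℝ) (hX : ∀ j, X j ∈ inputSpace d T)
    {νc νu νw : ℝ} (v : Neuron d → Neuron d) (hv : IsBoundedTransport v νc νu νw)
    {Ω : Type*} [MeasurableSpace Ω] (P : Measure Ω) [IsProbabilityMeasure P]
    (φ₀ : Ω → Params d m) (hφ₀ : HasLaw φ₀ (symmetricInitLaw d hm) P)
    {δ : ℝ} (hδ : δ ∈ Set.Ioo (0 : ℝ) 1) :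
    ENNReal.ofReal (1 - δ) ≤
      P {ω | (⨆ j : Fin n,
          |linModel σ q (φ₀ ω) (X j) (transported v (φ₀ ω)) - transportFun σ q v (X j)|) ≤
        2 * (σ₀ * νc + σ₁ * νu + σ₁ * νw) * √(2 * Real.log (2 * n / δ) / m)} := by
  have hm2 : 2 * (m / 2) = m := Nat.two_mul_div_two_of_even hm
  have hN : 0 < m / 2 := by omega
  have hmR : (m : ℝ) = 2 * ((m / 2 : ℕ) : ℝ) := by exact_mod_cast hm2.symm
  have : Nonempty (Fin n) := ⟨⟨0, hn⟩⟩
  have hσm : Measurable σ := hσ.differentiable.continuous.measurable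
  set μ := Measure.pi fun _ : Fin (m / 2) => neuronLaw d
  set b := 2 * (σ₀ * νc + σ₁ * νu + σ₁ * νw) *
    √(2 * Real.log (2 * n / δ) / (2 * ((m / 2 : ℕ) : ℝ)))
  -- `C` is the almost sure event that all output weights are `±1`, needed for the exact formula
  -- `linModel_mirror`; `E` is the event that concentration fails at some input.
  let C : Set (Fin (m / 2) → Neuron d) := ⋂ i, {θ | (θ i).c ^ 2 = 1}
  let E : Set (Fin (m / 2) → Neuron d) := ⋃ j, {θ | b < |(1 / (m / 2 : ℕ) : ℝ) *
    ∑ i, mirroredFeature σ (q (X j)) (X j) v (θ i) - transportFun σ q v (X j)|}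
  have hCm : MeasurableSet C := MeasurableSet.iInter fun i =>
    measurableSet_eq_fun ((measurable_neuron_c.comp (measurable_pi_apply i)).pow_const 2)
      measurable_const
  have hEm : MeasurableSet E := by
    refine MeasurableSet.iUnion fun j => measurableSet_lt measurable_const ?_
    refine Measurable.abs (Measurable.sub_const (Measurable.const_mul ?_ _) _)
    exact Finset.measurable_fun_sum _ fun i _ =>
      (measurable_mirroredFeature hσm hv.measurable _ _).comp (measurable_pi_apply i)
  have hCae : ∀ᵐ θ ∂μ, ∀ i, (θ i).c ^ 2 = 1 := ae_all_iff.2 fun i =>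
    (measurePreserving_eval (fun _ : Fin (m / 2) => neuronLaw d) i).quasiMeasurePreserving.ae
      ae_c_sq_eq_one
  have hE : μ.real E ≤ δ := by
    have h := measureReal_exists_mirroredFeature_le hN hn hσ q hq X hX hv hδ
    rwa [Set.ofPred_exists] at h
  have hG : ENNReal.ofReal (1 - δ) ≤ μ (C ∩ Eᶜ) := by
    have h1 : μ (C ∩ Eᶜ) = μ Eᶜ := measure_congr (by
      filter_upwards [hCae] with θ hθ
      exact propext ⟨fun h => h.2, fun h => ⟨Set.mem_iInter.2 hθ, h⟩⟩)
    rw [h1, ← ofReal_measureReal, probReal_compl_eq_one_sub hEm]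
    exact ENNReal.ofReal_le_ofReal (by linarith)
  refine hG.trans (measure_le_of_mirror hm hφ₀ (hCm.inter hEm.compl)
    (S := {φ | (⨆ j : Fin n, |linModel σ q φ (X j) (transported v φ) - transportFun σ q v (X j)|) ≤
      2 * (σ₀ * νc + σ₁ * νu + σ₁ * νw) * √(2 * Real.log (2 * n / δ) / m)}) ?_)
  rintro θ ⟨hθC, hθE⟩
  have hc : ∀ i, (θ i).c ^ 2 = 1 := fun i => Set.mem_iInter.1 hθC i
  rw [Set.mem_ofPred_eq]
  refine ciSup_le fun j => ?_
  rw [linModel_mirror hσ.differentiable q (X j) v hm θ hc, hmR]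
  exact not_lt.1 fun h => hθE (Set.mem_iUnion.2 ⟨j, h⟩)
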